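/- For $v\in\mathbb{R}^n$, access $SQ(v)$ allows the following queries: ask for an entry $v_i$, ask for $\|v\|$ (the $\ell_2$ norm), or ask for a fresh independent sample of an index $i$ with probability $v_i^2/\|v\|^2$. For $M\in\mathbb{R}^{n\times n}$, access $SQ(M)$ means $SQ$ access to every row of $M$, to every column of $M$, to the vector of row norms and to the vector of column norms. A quantum-inspired classical (QIC) algorithm is a randomized, adaptive algorithm that has access $SQ(M)$ and $SQ(y)$ and outputs an index; it solves the linear system $Mx=y$ ($M$ real symmetric of full rank) to precision $\varepsilon>0$ if there is a vector $\tilde x$ with $\|\tilde x-x\|\le\varepsilon\|x\|$, where $x=M^{-1}y$, such that it outputs each index $i$ with probability $\tilde x_i^2/\|\tilde x\|^2$. The condition number of $M$ is $\kappa(M)=\sigma_{\max}(M)/\sigma_{\min}(M)$, and $M$ has 3-sparse rows and columns if every row and every column has at most $3$ non-zero entries. Let $e_1$ be the first standard unit vector. **Theorem.** There are constants $c>0$ and $C>0$ such that the following holds for all $n\ge c$ and all $0<\varepsilon\le (c\sqrt{\ln n})^{-1}$. Let $\mathcal{M}$ be the set of full-rank symmetric real $n\times n$ matrices $M$ with condition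 number $\kappa(M)\le c\ln n$ and 3-sparse rows and columns. For every QIC algorithm $\mathcal{A}$ that solves $Mx=e_1$ to precision $\varepsilon$ for every $M\in\mathcal{M}$ (in particular, for every QIC algorithm that solves all linear systems with full-rank symmetric real $n\times n$ matrices to precision $\varepsilon$), there is a matrix $M\in\mathcal{M}$ such that the expected number of queries to $SQ(M)$ that $\mathcal{A}$ makes on the linear system $Mx=e_1$ is at least $C\,n^{1/4}/\ln^{3/2}n$. In particular, $\mathcal{A}$ makes at least that many queries in the worst case over its randomness. -/

import Mathlib

open scoped ENNReal

/-! Quantum-inspired classical (QIC) algorithms: randomized adaptive query algorithms with sampling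
and query access to the input `(M, y)` of a linear system `M x = y`. -/

/-- The vectors to which an algorithm has sampling and query access: the rows and the columns of
`M`, the vector of row norms, the vector of column norms, and the right-hand side `y`. -/
inductive SQVector (n : ℕ) : Type
  | row (i : Fin n)
  | col (j : Fin n)
  | rowNorms
  | colNorms
  | rhs

/-- The actual vector, for a given input `(M, y)`. -/
noncomputable def SQVector.vec {n : ℕ} (M : Matrix (Fin n) (Fin n) ℝ)
    (y : EuclideanSpace ℝ (Fin n)) : SQVector n → EuclideanSpace ℝ (Fin n)
  | .row i => WithLp.toLp 2 (fun j => M i j)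
  | .col j => WithLp.toLp 2 (fun i => M i j)
  | .rowNorms => WithLp.toLp 2 (fun i => ‖(WithLp.toLp 2 (fun j => M i j) : EuclideanSpace ℝ (Fin n))‖)
  | .colNorms => WithLp.toLp 2 (fun j => ‖(WithLp.toLp 2 (fun i => M i j) : EuclideanSpace ℝ (Fin n))‖)
  | .rhs => y

/-- The number of queries to `SQ(M)` that one access to the vector accounts for: accesses to the
right-hand side are free. -/
def SQVector.cost {n : ℕ} : SQVector n → ℕ
  | .rhs => 0
  | _ => 1

/-- What an algorithm can do next: stop with an output index, query an entry of a vector, query the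
norm of a vector, or ask for a sample from a vector. -/
inductive QICAction (n : ℕ) : Type
  | output (i : Fin n)
  | entry (v : SQVector n) (i : Fin n)
  | norm (v : SQVector n)
  | sample (v : SQVector n)

/-- The answer to a query: a real number, or a sampled index. -/
inductive QICAnswer (n : ℕ) : Type
  | value (a : ℝ)
  | index (i : Fin n)

/-- A deterministic strategy: the next action, given all the answers so far (latest first). -/
abbrev QICStrategy (n : ℕ) : Type := List (QICAnswer n) → QICAction n

/-- The probability that a sample from `v` is `j`, namely `v j ^ 2 / ‖v‖ ^ 2`. -/
noncomputable def sampleProb {n : ℕ} (v : EuclideanSpace ℝ (Fin n)) (j : Fin n) : ℝ≥0∞ :=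
  ENNReal.ofReal (v j ^ 2 / ‖v‖ ^ 2)

namespace QICStrategy

/-- The probability, over the answers to the sampling queries, that the strategy `S`, having
received the answers `h`, stops after fewer than `d` further queries and outputs `i`. -/
noncomputable def outputProbWithin {n : ℕ} (S : QICStrategy n) (M : Matrix (Fin n) (Fin n) ℝ)
    (y : EuclideanSpace ℝ (Fin n)) (i : Fin n) : ℕ → List (QICAnswer n) → ℝ≥0∞
  | 0, _ => 0
  | d + 1, h =>
    match S h with
    | .output j => if j = i then 1 else 0
    | .entry v j => outputProbWithin S M y i d (.value (v.vec M y j) :: h)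
    | .norm v => outputProbWithin S M y i d (.value ‖v.vec M y‖ :: h)
    | .sample v => ∑ j, sampleProb (v.vec M y) j * outputProbWithin S M y i d (.index j :: h)

/-- The expected number of queries to `SQ(M)` among the next `d` queries that the strategy `S`
makes, having received the answers `h`. -/
noncomputable def expectedQueriesWithin {n : ℕ} (S : QICStrategy n)
    (M : Matrix (Fin n) (Fin n) ℝ) (y : EuclideanSpace ℝ (Fin n)) :
    ℕ → List (QICAnswer n) → ℝ≥0∞
  | 0, _ => 0
  | d + 1, h =>
    match S h with
    | .output _ => 0
    | .entry v j => v.cost + expectedQueriesWithin S M y d (.value (v.vec M y j) :: h)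
    | .norm v => v.cost + expectedQueriesWithin S M y d (.value ‖v.vec M y‖ :: h)
    | .sample v =>
      v.cost + ∑ j, sampleProb (v.vec M y) j * expectedQueriesWithin S M y d (.index j :: h)

end QICStrategy

/-- A QIC algorithm for inputs of dimension `n`: its internal randomness is a random seed, which is
independent of the answers to its sampling queries; given the seed it follows a deterministic
strategy. The algorithm is free to run for an unbounded number of queries. -/
structure QICAlgorithm (n : ℕ) where
  Seed : Type
  [seedSpace : MeasurableSpace Seed]
  seedLaw : MeasureTheory.Measure Seed
  [seedLaw_prob : MeasureTheory.IsProbabilityMeasure seedLaw]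
  strategy : Seed → QICStrategy n
  measurable_strategy : ∀ (h : List (QICAnswer n)) (a : QICAction n),
    MeasurableSet {ω | strategy ω h = a}

namespace QICAlgorithm

attribute [instance] QICAlgorithm.seedSpace QICAlgorithm.seedLaw_prob

/-- The probability that the algorithm stops and outputs `i` on the input `(M, y)`. -/
noncomputable def outputProb {n : ℕ} (A : QICAlgorithm n) (M : Matrix (Fin n) (Fin n) ℝ)
    (y : EuclideanSpace ℝ (Fin n)) (i : Fin n) : ℝ≥0∞ :=
  ∫⁻ ω, ⨆ d : ℕ, (A.strategy ω).outputProbWithin M y i d [] ∂A.seedLaw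

/-- The expected number of queries to `SQ(M)` that the algorithm makes on the input `(M, y)`. -/
noncomputable def expectedQueries {n : ℕ} (A : QICAlgorithm n) (M : Matrix (Fin n) (Fin n) ℝ)
    (y : EuclideanSpace ℝ (Fin n)) : ℝ≥0∞ :=
  ∫⁻ ω, ⨆ d : ℕ, (A.strategy ω).expectedQueriesWithin M y d [] ∂A.seedLaw

/-- The algorithm solves the linear system `M x = y` to precision `ε`: it outputs an index sampled
from some vector `x'` with `‖x' - x‖ ≤ ε * ‖x‖`, where `x = M⁻¹ y`. -/
def Solves {n : ℕ} (A : QICAlgorithm n) (M : Matrix (Fin n) (Fin n) ℝ)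
    (y : EuclideanSpace ℝ (Fin n)) (ε : ℝ) : Prop :=
  ∃ x' : EuclideanSpace ℝ (Fin n),
    ‖x' - WithLp.toLp 2 (M⁻¹.mulVec y.ofLp)‖ ≤
      ε * ‖(WithLp.toLp 2 (M⁻¹.mulVec y.ofLp) : EuclideanSpace ℝ (Fin n))‖ ∧
    ∀ i, A.outputProb M y i = sampleProb x' i

end QICAlgorithm

/-- The condition number: the largest singular value divided by the smallest one. -/
noncomputable def conditionNumber {n : ℕ} (M : Matrix (Fin n) (Fin n) ℝ) : ℝ :=
  (Matrix.toEuclideanLin M).singularValues 0 / (Matrix.toEuclideanLin M).singularValues (n - 1)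

/-- A full-rank symmetric matrix with condition number at most `K` and at most `s` non-zero entries
in every row and every column. -/
structure IsSparseWellConditioned {n : ℕ} (s : ℕ) (K : ℝ) (M : Matrix (Fin n) (Fin n) ℝ) :
    Prop where
  symm : M.IsSymm
  rank_eq : M.rank = n
  cond_le : conditionNumber M ≤ K
  row_sparse : ∀ i, {j | M i j ≠ 0}.ncard ≤ s
  col_sparse : ∀ j, {i | M i j ≠ 0}.ncard ≤ s

/-- The first standard unit vector. -/
noncomputable def firstUnitVector (n : ℕ) : EuclideanSpace ℝ (Fin n) :=
  WithLp.toLp 2 (fun i => if (i : ℕ) = 0 then 1 else 0)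

/-!
A small quantum circuit is hidden in the matrix, as in Simon's problem. For a Boolean function `f`
on the cube `𝔽₂ ^ k`, with `4 ^ k ≤ n < 4 ^ (k + 1)`, the circuit applies a Hadamard gate to each
bit, then the signs `(-1) ^ f x`, then the Hadamard gates again in reverse order. The history
`∑ t, |t⟩ ⊗ ψ_t` of its `2 k + 2` states solves `(1 - L) u = e` for a nilpotent contraction `L`, so
this system has condition number `O(k)`. The circuit is a palindrome of symmetric gates, hence
reversing the time in the rows makes the matrix symmetric (`historyMatrix`). It is 3-sparse, since
a gate has at most two non-zero entries in a row.

*What a correct algorithm does.* A `1 / (2 k + 2)` fraction of the squared norm of the solution sits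
at the final time, so an approximate solver outputs a pair (final time, `y`) with probability of
order `1 / log n` (`le_sum_outputProb_final`). If `f (x + s) = !f x` for all `x`, the final state
vanishes at each `y` orthogonal to `s` (`circuitState_final_eq_zero`), so such a `y` is output with
probability at most `4 ε ^ 2` (`sum_outputProb_orthogonal_le`).

*What a cheap algorithm cannot do.* The squared entries of the matrix do not depend on `f`;
therefore neither do norms and samples, and an entry query reveals at most one value of `f`
(`hidesFunction_hardMatrix`). As long as no two of the queried points differ by `s`, a random `f`
with `f (x + s) = !f x` cannot be distinguished from a random `f` (`sum_consistent_antiperiodize`).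
A fixed `y` is orthogonal to at least half of all `s`, and `t` queries rule out at most `t ^ 2`
shifts `s`. So if the expected number of queries is far below `t / log n`, with `t` of order
`√(2 ^ k)`, the algorithm still outputs a `y` orthogonal to a random hidden shift `s` with
probability of order `1 / log n` (`QICAlgorithm.hiding_bound`). This contradicts the bound
`4 ε ^ 2`, and `√(2 ^ k)` is of order `n ^ (1 / 4)`.
-/

/-! ### Sampling probabilities -/

lemma sum_sampleProb_le_one {n : ℕ} (v : EuclideanSpace ℝ (Fin n)) :
    ∑ j, sampleProb v j ≤ 1 := by
  unfold sampleProb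
  rw [← ENNReal.ofReal_sum_of_nonneg (fun _ _ => by positivity), ← Finset.sum_div,
    ENNReal.ofReal_le_one, EuclideanSpace.real_norm_sq_eq]
  exact div_self_le_one _

lemma norm_eq_of_sq_eq {n : ℕ} {v w : EuclideanSpace ℝ (Fin n)} (h : ∀ j, v j ^ 2 = w j ^ 2) :
    ‖v‖ = ‖w‖ := by
  rw [← sq_eq_sq₀ (norm_nonneg _) (norm_nonneg _), EuclideanSpace.real_norm_sq_eq,
    EuclideanSpace.real_norm_sq_eq]
  exact Finset.sum_congr rfl fun j _ => h j

lemma sampleProb_eq_of_sq_eq {n : ℕ} {v w : EuclideanSpace ℝ (Fin n)}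
    (h : ∀ j, v j ^ 2 = w j ^ 2) : sampleProb v = sampleProb w := by
  funext j
  rw [sampleProb, sampleProb, h j, norm_eq_of_sq_eq h]

/-! ### Measurability and monotonicity in the number of queries -/

instance (n : ℕ) : Countable (SQVector n) := by
  let e : SQVector n → (Fin n ⊕ Fin n) ⊕ Fin 3 := fun v => match v with
    | .row i => .inl (.inl i)
    | .col i => .inl (.inr i)
    | .rowNorms => .inr 0
    | .colNorms => .inr 1
    | .rhs => .inr 2
  refine Function.Injective.countable (f := e) ?_
  rintro (_ | _ | _ | _ | _) (_ | _ | _ | _ | _) h <;> simp_all [e]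

instance (n : ℕ) : Countable (QICAction n) := by
  let e : QICAction n → (Fin n ⊕ SQVector n × Fin n) ⊕ (SQVector n ⊕ SQVector n) := fun a =>
    match a with
    | .output i => .inl (.inl i)
    | .entry v i => .inl (.inr (v, i))
    | .norm v => .inr (.inl v)
    | .sample v => .inr (.inr v)
  refine Function.Injective.countable (f := e) ?_
  rintro (_ | _ | _ | _) (_ | _ | _ | _) h <;> simp_all [e]

/-- A function that depends on the seed through the action after a fixed history, and measurably so
for each action, is measurable: there are only countably many actions. -/
lemma QICAlgorithm.measurable_of_action {n : ℕ} (A : QICAlgorithm n) (h : List (QICAnswer n))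
    (F : QICAction n → A.Seed → ℝ≥0∞) (hF : ∀ a, Measurable (F a)) :
    Measurable fun ω => F (A.strategy ω h) ω := by
  intro s hs
  have : (fun ω => F (A.strategy ω h) ω) ⁻¹' s
      = ⋃ a, ({ω | A.strategy ω h = a} ∩ F a ⁻¹' s) := by
    ext ω
    simp
  rw [this]
  exact MeasurableSet.iUnion fun a => (A.measurable_strategy h a).inter (hF a hs)

lemma QICAlgorithm.measurable_outputProbWithin {n : ℕ} (A : QICAlgorithm n)
    (M : Matrix (Fin n) (Fin n) ℝ) (y : EuclideanSpace ℝ (Fin n)) (i : Fin n) (d : ℕ) :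
    ∀ h, Measurable fun ω => (A.strategy ω).outputProbWithin M y i d h := by
  induction d with
  | zero => intro h; exact measurable_const
  | succ d ih =>
    intro h
    simp only [QICStrategy.outputProbWithin]
    refine A.measurable_of_action h (fun a ω => match a with
      | .output j => if j = i then 1 else 0
      | .entry v j => (A.strategy ω).outputProbWithin M y i d (.value (v.vec M y j) :: h)
      | .norm v => (A.strategy ω).outputProbWithin M y i d (.value ‖v.vec M y‖ :: h)
      | .sample v => ∑ j, sampleProb (v.vec M y) j *
          (A.strategy ω).outputProbWithin M y i d (.index j :: h)) ?_
    rintro (j | ⟨v, j⟩ | v | v)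
    · exact measurable_const
    · exact ih _
    · exact ih _
    · exact Finset.measurable_sum _ fun j _ => (ih _).const_mul _

lemma QICAlgorithm.measurable_expectedQueriesWithin {n : ℕ} (A : QICAlgorithm n)
    (M : Matrix (Fin n) (Fin n) ℝ) (y : EuclideanSpace ℝ (Fin n)) (d : ℕ) :
    ∀ h, Measurable fun ω => (A.strategy ω).expectedQueriesWithin M y d h := by
  induction d with
  | zero => intro h; exact measurable_const
  | succ d ih =>
    intro h
    simp only [QICStrategy.expectedQueriesWithin]
    refine A.measurable_of_action h (fun a ω => match a with
      | .output j => 0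
      | .entry v j =>
        v.cost + (A.strategy ω).expectedQueriesWithin M y d (.value (v.vec M y j) :: h)
      | .norm v => v.cost + (A.strategy ω).expectedQueriesWithin M y d (.value ‖v.vec M y‖ :: h)
      | .sample v => v.cost + ∑ j, sampleProb (v.vec M y) j *
          (A.strategy ω).expectedQueriesWithin M y d (.index j :: h)) ?_
    rintro (j | ⟨v, j⟩ | v | v)
    · exact measurable_const
    · exact (ih _).const_add _
    · exact (ih _).const_add _
    · exact (Finset.measurable_sum _ fun j _ => (ih _).const_mul _).const_add _

lemma QICStrategy.monotone_outputProbWithin {n : ℕ} (S : QICStrategy n)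
    (M : Matrix (Fin n) (Fin n) ℝ) (y : EuclideanSpace ℝ (Fin n)) (i : Fin n)
    (h : List (QICAnswer n)) : Monotone fun d => S.outputProbWithin M y i d h := by
  refine monotone_nat_of_le_succ fun d => ?_
  induction d generalizing h with
  | zero => simp [outputProbWithin]
  | succ d ih =>
    rw [outputProbWithin, outputProbWithin]
    cases S h with
    | output j => exact le_rfl
    | entry v j => exact ih _
    | norm v => exact ih _
    | sample v => exact Finset.sum_le_sum fun j _ => mul_le_mul_right (ih _) _

/-! ### Matrices with a hidden sign function, and the transcript of a run -/

/-- A family of matrices indexed by Boolean functions `f`, in which a vector `v` accessible to an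
algorithm depends on `f` through the single value at `pt v` (not at all if `pt v` is `none`), and
the squared entries do not depend on `f`. Then norms and samples carry no information about `f`,
and the answer to an entry query reveals at most one value of `f`. -/
structure HidesFunction {n : ℕ} {X : Type*} (M : (X → Bool) → Matrix (Fin n) (Fin n) ℝ)
    (y : EuclideanSpace ℝ (Fin n)) (pt : SQVector n → Option X) : Prop where
  vec_eq : ∀ (f f' : X → Bool) (v : SQVector n), (∀ x ∈ pt v, f x = f' x) →
    v.vec (M f) y = v.vec (M f') y
  sq_eq : ∀ (f f' : X → Bool) (v : SQVector n) (j : Fin n),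
    v.vec (M f) y j ^ 2 = v.vec (M f') y j ^ 2
  cost_eq : ∀ v : SQVector n, pt v ≠ none → v.cost = 1

/-- The list of revealed values of `f` after an entry query to `v`. -/
def revealed {n : ℕ} {X : Type*} (pt : SQVector n → Option X) (f : X → Bool) (v : SQVector n)
    (Q : List (X × Bool)) : List (X × Bool) :=
  (pt v).elim Q fun x => (x, f x) :: Q

/-- The expectation of `α j Q` over the runs of the strategy `S` that stop within `d` queries, where
`j` is the output and `Q` lists the values of `f` that the run has revealed. -/
noncomputable def QICStrategy.transcriptValue {n : ℕ} {X : Type*} (S : QICStrategy n)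
    (M : (X → Bool) → Matrix (Fin n) (Fin n) ℝ) (y : EuclideanSpace ℝ (Fin n))
    (pt : SQVector n → Option X) (α : Fin n → List (X × Bool) → ℝ≥0∞) (f : X → Bool) :
    ℕ → List (QICAnswer n) → List (X × Bool) → ℝ≥0∞
  | 0, _, _ => 0
  | d + 1, h, Q =>
    match S h with
    | .output j => α j Q
    | .entry v j =>
      S.transcriptValue M y pt α f d (.value (v.vec (M f) y j) :: h) (revealed pt f v Q)
    | .norm v => S.transcriptValue M y pt α f d (.value ‖v.vec (M f) y‖ :: h) Q
    | .sample v =>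
      ∑ j, sampleProb (v.vec (M f) y) j * S.transcriptValue M y pt α f d (.index j :: h) Q

namespace QICStrategy

variable {n : ℕ} {X : Type*} (S : QICStrategy n) (M : (X → Bool) → Matrix (Fin n) (Fin n) ℝ)
  (y : EuclideanSpace ℝ (Fin n)) (pt : SQVector n → Option X)

lemma transcriptValue_mono {α β : Fin n → List (X × Bool) → ℝ≥0∞} (hαβ : ∀ j Q, α j Q ≤ β j Q)
    (f : X → Bool) (d : ℕ) : ∀ h Q,
      S.transcriptValue M y pt α f d h Q ≤ S.transcriptValue M y pt β f d h Q := by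
  induction d with
  | zero => intro h Q; exact le_rfl
  | succ d ih =>
    intro h Q
    rw [transcriptValue, transcriptValue]
    cases S h with
    | output j => exact hαβ j Q
    | entry v j => exact ih _ _
    | norm v => exact ih _ _
    | sample v => exact Finset.sum_le_sum fun j _ => mul_le_mul_right (ih _ _) _

lemma transcriptValue_add (α β : Fin n → List (X × Bool) → ℝ≥0∞) (f : X → Bool) (d : ℕ) :
    ∀ h Q, S.transcriptValue M y pt (fun j Q => α j Q + β j Q) f d h Q
      = S.transcriptValue M y pt α f d h Q + S.transcriptValue M y pt β f d h Q := by
  induction d with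
  | zero => intro h Q; simp [transcriptValue]
  | succ d ih =>
    intro h Q
    rw [transcriptValue, transcriptValue, transcriptValue]
    cases S h with
    | output j => rfl
    | entry v j => exact ih _ _
    | norm v => exact ih _ _
    | sample v => simp only [ih, mul_add, Finset.sum_add_distrib]

lemma transcriptValue_const_mul (c : ℝ≥0∞) (α : Fin n → List (X × Bool) → ℝ≥0∞) (f : X → Bool)
    (d : ℕ) : ∀ h Q, S.transcriptValue M y pt (fun j Q => c * α j Q) f d h Q
      = c * S.transcriptValue M y pt α f d h Q := by
  induction d with
  | zero => intro h Q; simp [transcriptValue]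
  | succ d ih =>
    intro h Q
    rw [transcriptValue, transcriptValue]
    cases S h with
    | output j => rfl
    | entry v j => exact ih _ _
    | norm v => exact ih _ _
    | sample v => simp only [ih, Finset.mul_sum, mul_left_comm c]

lemma transcriptValue_sum {ι : Type*} (s : Finset ι) (α : ι → Fin n → List (X × Bool) → ℝ≥0∞)
    (f : X → Bool) (d : ℕ) (h : List (QICAnswer n)) (Q : List (X × Bool)) :
    S.transcriptValue M y pt (fun j Q => ∑ a ∈ s, α a j Q) f d h Q
      = ∑ a ∈ s, S.transcriptValue M y pt (α a) f d h Q := by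
  classical
  induction s using Finset.induction_on with
  | empty =>
    simpa using S.transcriptValue_const_mul M y pt 0 (fun _ _ => 0) f d h Q
  | insert a s ha ih =>
    simp only [Finset.sum_insert ha]
    rw [transcriptValue_add, ih]

lemma transcriptValue_eq_sum_outputProbWithin (β : Fin n → ℝ≥0∞) (f : X → Bool) (d : ℕ) :
    ∀ h Q, S.transcriptValue M y pt (fun j _ => β j) f d h Q
      = ∑ i, β i * S.outputProbWithin (M f) y i d h := by
  induction d with
  | zero => intro h Q; simp [transcriptValue, outputProbWithin]
  | succ d ih =>
    intro h Q
    simp only [transcriptValue, outputProbWithin]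
    cases S h with
    | output j => simp
    | entry v j => exact ih _ _
    | norm v => exact ih _ _
    | sample v =>
      simp only [ih, Finset.mul_sum]
      rw [Finset.sum_comm]
      exact Finset.sum_congr rfl fun i _ => Finset.sum_congr rfl fun j _ => mul_left_comm _ _ _

variable {M y pt}

/-- Every revealed value of `f` costs a query. -/
lemma transcriptValue_length_le (hM : HidesFunction M y pt) (f : X → Bool) (d : ℕ) :
    ∀ h Q, S.transcriptValue M y pt (fun _ Q => (Q.length : ℝ≥0∞)) f d h Q
      ≤ Q.length + S.expectedQueriesWithin (M f) y d h := by
  induction d with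
  | zero => intro h Q; simp [transcriptValue]
  | succ d ih =>
    intro h Q
    rw [transcriptValue, expectedQueriesWithin]
    cases S h with
    | output j => simp
    | entry v j =>
      refine (ih _ _).trans ?_
      rw [← add_assoc]
      gcongr
      have := hM.cost_eq v
      unfold revealed
      cases hv : pt v with
      | none => simp
      | some x => simp [this (by simp [hv])]
    | norm v =>
      refine (ih _ _).trans ?_
      gcongr
      exact le_add_self
    | sample v =>
      calc ∑ j, sampleProb (v.vec (M f) y) j * _
          ≤ ∑ j, sampleProb (v.vec (M f) y) j *
              (Q.length + S.expectedQueriesWithin (M f) y d (.index j :: h)) :=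
            Finset.sum_le_sum fun j _ => mul_le_mul_right (ih _ _) _
        _ = (∑ j, sampleProb (v.vec (M f) y) j) * Q.length +
              ∑ j, sampleProb (v.vec (M f) y) j *
                S.expectedQueriesWithin (M f) y d (.index j :: h) := by
            simp only [mul_add, Finset.sum_add_distrib, Finset.sum_mul]
        _ ≤ _ := by
            refine add_le_add ((mul_le_mul_left (sum_sampleProb_le_one _) _).trans ?_) le_add_self
            rw [one_mul]

end QICStrategy

/-- Indicator of the event that the list `Q` of revealed values is consistent with `f`. -/
noncomputable def consistent {X : Type*} (Q : List (X × Bool)) (f : X → Bool) : ℝ≥0∞ :=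
  open scoped Classical in if ∀ p ∈ Q, f p.1 = p.2 then 1 else 0

lemma consistent_nil {X : Type*} (f : X → Bool) : consistent [] f = 1 := by
  simp [consistent]

lemma consistent_cons {X : Type*} (Q : List (X × Bool)) (f : X → Bool) (x : X) (b : Bool) :
    consistent ((x, b) :: Q) f = if f x = b then consistent Q f else 0 := by
  classical
  by_cases hb : f x = b <;> simp [consistent, hb]

/-- If the function `F g` with random `g` agrees with any list of values for which `α` does not
vanish with at least the probability that `g` does, then the expectation of `α` is at least as large
on the input `F g` as on `g`. -/
lemma QICStrategy.sum_transcriptValue_le {n : ℕ} {X : Type*} [Fintype X] [DecidableEq X]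
    (S : QICStrategy n)
    {M : (X → Bool) → Matrix (Fin n) (Fin n) ℝ} {y : EuclideanSpace ℝ (Fin n)}
    {pt : SQVector n → Option X} (hM : HidesFunction M y pt) (F : (X → Bool) → X → Bool)
    (α : Fin n → List (X × Bool) → ℝ≥0∞)
    (hα : ∀ j Q, α j Q ≠ 0 → ∑ g, consistent Q g ≤ ∑ g, consistent Q (F g)) (d : ℕ) :
    ∀ h Q, ∑ g, consistent Q g * S.transcriptValue M y pt α g d h Q
      ≤ ∑ g, consistent Q (F g) * S.transcriptValue M y pt α (F g) d h Q := by
  induction d with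
  | zero => intro h Q; simp [transcriptValue]
  | succ d ih =>
    intro h Q
    simp only [transcriptValue]
    cases S h with
    | output j =>
      simp only [← Finset.sum_mul]
      by_cases h0 : α j Q = 0
      · simp [h0]
      · exact mul_le_mul_left (hα j Q h0) _
    | entry v j =>
      have key : ∀ f : X → Bool, consistent Q f *
          S.transcriptValue M y pt α f d (.value (v.vec (M f) y j) :: h) (revealed pt f v Q)
          = (pt v).elim (consistent Q f * S.transcriptValue M y pt α f d
              (.value (v.vec (M fun _ => true) y j) :: h) Q)
            fun x => ∑ b, consistent ((x, b) :: Q) f * S.transcriptValue M y pt α f d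
              (.value (v.vec (M fun _ => b) y j) :: h) ((x, b) :: Q) := by
        intro f
        cases hv : pt v with
        | none =>
          rw [hM.vec_eq f (fun _ => true) v (by simp [hv])]
          simp [revealed, hv]
        | some x =>
          rw [hM.vec_eq f (fun _ => f x) v (by simp [hv])]
          simp only [revealed, hv, Option.elim, consistent_cons, ite_mul, zero_mul,
            Finset.sum_ite_eq, Finset.mem_univ, if_true]
      simp only [key]
      cases hv : pt v with
      | none => exact ih _ _
      | some x =>
        simp only [Option.elim]
        rw [Finset.sum_comm, Finset.sum_comm (s := Finset.univ (α := X → Bool))]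
        exact Finset.sum_le_sum fun b _ => ih _ _
    | norm v =>
      have key : ∀ f : X → Bool, ‖v.vec (M f) y‖ = ‖v.vec (M fun _ => true) y‖ :=
        fun f => norm_eq_of_sq_eq (hM.sq_eq _ _ v)
      simp only [key]
      exact ih _ _
    | sample v =>
      have key : ∀ f : X → Bool,
          sampleProb (v.vec (M f) y) = sampleProb (v.vec (M fun _ => true) y) :=
        fun f => sampleProb_eq_of_sq_eq (hM.sq_eq _ _ v)
      simp only [key, Finset.mul_sum, mul_left_comm (consistent _ _)]
      rw [Finset.sum_comm, Finset.sum_comm (s := Finset.univ (α := X → Bool))]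
      simp only [← Finset.mul_sum]
      exact Finset.sum_le_sum fun j _ => mul_le_mul_right (ih _ _) _

/-- The bound of `QICAlgorithm.hiding_bound` for a deterministic strategy and runs of bounded
length. -/
lemma QICStrategy.hiding_bound {n : ℕ} {X σ : Type*} [Fintype X] [DecidableEq X]
    (S : QICStrategy n) {M : (X → Bool) → Matrix (Fin n) (Fin n) ℝ} {y : EuclideanSpace ℝ (Fin n)}
    {pt : SQVector n → Option X} (hM : HidesFunction M y pt) {t : ℕ} (ht : 0 < t) (K : ℝ≥0∞)
    (T : Finset (Fin n)) (I : Finset σ) (F : σ → (X → Bool) → X → Bool)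
    (B : σ → Finset (Fin n)) (free : σ → List (X × Bool) → Prop)
    (hfree : ∀ s ∈ I, ∀ Q, free s Q → ∑ g, consistent Q g ≤ ∑ g, consistent Q (F s g))
    (hcount : ∀ j ∈ T, ∀ Q : List (X × Bool), Q.length ≤ t →
      K ≤ ((open scoped Classical in I.filter fun s => j ∈ B s ∧ free s Q).card : ℝ≥0∞))
    (d : ℕ) :
    K * ∑ g, ∑ j ∈ T, S.outputProbWithin (M g) y j d []
      ≤ ∑ s ∈ I, ∑ g, ∑ j ∈ B s, S.outputProbWithin (M (F s g)) y j d []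
        + K / t * ∑ g, S.expectedQueriesWithin (M g) y d [] := by
  classical
  let α : σ → Fin n → List (X × Bool) → ℝ≥0∞ := fun s j Q => if j ∈ B s ∧ free s Q then 1 else 0
  have ht' : (t : ℝ≥0∞) ≠ 0 := by exact_mod_cast ht.ne'
  have hout : ∀ (U : Finset (Fin n)) (f : X → Bool),
      ∑ j ∈ U, S.outputProbWithin (M f) y j d []
        = S.transcriptValue M y pt (fun j _ => if j ∈ U then 1 else 0) f d [] [] := by
    intro U f
    rw [transcriptValue_eq_sum_outputProbWithin]
    simp [Finset.sum_ite_mem]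
  have hpoint : ∀ j Q, K * (if j ∈ T then 1 else 0)
      ≤ (∑ s ∈ I, α s j Q) + K / t * (Q.length : ℝ≥0∞) := by
    intro j Q
    by_cases hj : j ∈ T
    · rw [if_pos hj, mul_one]
      by_cases hQ : Q.length ≤ t
      · refine le_add_right ((hcount j hj Q hQ).trans (le_of_eq ?_))
        simp only [α, Finset.sum_boole]
      · refine le_add_left ?_
        calc K = K / t * t := (ENNReal.div_mul_cancel ht' (ENNReal.natCast_ne_top t)).symm
          _ ≤ K / t * Q.length := by
            gcongr
            exact_mod_cast (not_le.mp hQ).le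
    · simp [hj]
  have hg : ∀ g, K * ∑ j ∈ T, S.outputProbWithin (M g) y j d []
      ≤ (∑ s ∈ I, S.transcriptValue M y pt (α s) g d [] [])
        + K / t * S.expectedQueriesWithin (M g) y d [] := by
    intro g
    rw [hout, ← transcriptValue_const_mul]
    refine (S.transcriptValue_mono M y pt hpoint g d [] []).trans ?_
    rw [transcriptValue_add, transcriptValue_sum, transcriptValue_const_mul]
    gcongr
    simpa using S.transcriptValue_length_le hM g d [] []
  calc K * ∑ g, ∑ j ∈ T, S.outputProbWithin (M g) y j d []
      ≤ ∑ g, ((∑ s ∈ I, S.transcriptValue M y pt (α s) g d [] [])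
        + K / t * S.expectedQueriesWithin (M g) y d []) := by
        rw [Finset.mul_sum]
        exact Finset.sum_le_sum fun g _ => hg g
    _ = ∑ s ∈ I, ∑ g, S.transcriptValue M y pt (α s) g d [] []
        + K / t * ∑ g, S.expectedQueriesWithin (M g) y d [] := by
        rw [Finset.sum_add_distrib, Finset.sum_comm, Finset.mul_sum]
    _ ≤ _ := by
        refine add_le_add (Finset.sum_le_sum fun s hs => ?_) le_rfl
        have := S.sum_transcriptValue_le hM (F s) (α s) (fun j Q hne => by
          refine hfree s hs Q ?_
          by_contra hc
          exact hne (if_neg fun h => hc h.2)) d [] []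
        simp only [consistent_nil, one_mul] at this
        refine this.trans (Finset.sum_le_sum fun g _ => ?_)
        rw [hout]
        refine S.transcriptValue_mono M y pt (fun j Q => ?_) _ d [] []
        simp only [α]
        split_ifs <;> simp_all

/-- Let the functions `F s g` look like a random `g` as long as the list of revealed values is
`free` for `s`, and let every output in `T` together with every list of at most `t` values be
good (output in `B s`, list free for `s`) for at least `K` indices `s`. An algorithm which often
outputs an element of `T` on random inputs must then often output an element of `B s` on inputs
`F s g`, unless it makes many queries. -/
lemma QICAlgorithm.hiding_bound {n : ℕ} {X σ : Type*} [Fintype X] [DecidableEq X]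
    (A : QICAlgorithm n) {M : (X → Bool) → Matrix (Fin n) (Fin n) ℝ} {y : EuclideanSpace ℝ (Fin n)}
    {pt : SQVector n → Option X} (hM : HidesFunction M y pt) {t : ℕ} (ht : 0 < t) (K : ℝ≥0∞)
    (T : Finset (Fin n)) (I : Finset σ) (F : σ → (X → Bool) → X → Bool)
    (B : σ → Finset (Fin n)) (free : σ → List (X × Bool) → Prop)
    (hfree : ∀ s ∈ I, ∀ Q, free s Q → ∑ g, consistent Q g ≤ ∑ g, consistent Q (F s g))
    (hcount : ∀ j ∈ T, ∀ Q : List (X × Bool), Q.length ≤ t →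
      K ≤ ((open scoped Classical in I.filter fun s => j ∈ B s ∧ free s Q).card : ℝ≥0∞)) :
    K * ∑ g, ∑ j ∈ T, A.outputProb (M g) y j
      ≤ ∑ s ∈ I, ∑ g, ∑ j ∈ B s, A.outputProb (M (F s g)) y j
        + K / t * ∑ g, A.expectedQueries (M g) y := by
  have mo : ∀ (f : X → Bool) (j : Fin n), Measurable fun ω =>
      ⨆ d : ℕ, (A.strategy ω).outputProbWithin (M f) y j d [] := fun f j =>
    Measurable.iSup fun d => A.measurable_outputProbWithin (M f) y j d []
  have mq : ∀ f : X → Bool, Measurable fun ω =>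
      ⨆ d : ℕ, (A.strategy ω).expectedQueriesWithin (M f) y d [] := fun f =>
    Measurable.iSup fun d => A.measurable_expectedQueriesWithin (M f) y d []
  have mT : ∀ (U : Finset (Fin n)) (f : X → Bool), Measurable fun ω =>
      ∑ j ∈ U, ⨆ d : ℕ, (A.strategy ω).outputProbWithin (M f) y j d [] := fun U f =>
    Finset.measurable_sum _ fun j _ => mo f j
  have hsum : ∀ (U : Finset (Fin n)) (f : X → Bool), ∑ j ∈ U, A.outputProb (M f) y j
      = ∫⁻ ω, ∑ j ∈ U, ⨆ d : ℕ, (A.strategy ω).outputProbWithin (M f) y j d [] ∂A.seedLaw :=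
    fun U f => (MeasureTheory.lintegral_finsetSum _ fun j _ => mo f j).symm
  simp only [hsum]
  simp only [expectedQueries]
  rw [← MeasureTheory.lintegral_finsetSum _ fun g _ => mT T g,
    ← MeasureTheory.lintegral_const_mul _ (Finset.measurable_sum _ fun g _ => mT T g),
    ← MeasureTheory.lintegral_finsetSum _ fun g _ => mq g,
    ← MeasureTheory.lintegral_const_mul _ (Finset.measurable_sum _ fun g _ => mq g)]
  have : ∀ s, ∑ g, ∫⁻ ω, ∑ j ∈ B s, ⨆ d : ℕ,
      (A.strategy ω).outputProbWithin (M (F s g)) y j d [] ∂A.seedLaw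
      = ∫⁻ ω, ∑ g, ∑ j ∈ B s, ⨆ d : ℕ,
      (A.strategy ω).outputProbWithin (M (F s g)) y j d [] ∂A.seedLaw := fun s =>
    (MeasureTheory.lintegral_finsetSum _ fun g _ => mT (B s) (F s g)).symm
  simp only [this]
  rw [← MeasureTheory.lintegral_finsetSum _ fun s _ =>
      Finset.measurable_sum _ fun g _ => mT (B s) (F s g),
    ← MeasureTheory.lintegral_add_left (Finset.measurable_sum _ fun s _ =>
      Finset.measurable_sum _ fun g _ => mT (B s) (F s g))]
  refine MeasureTheory.lintegral_mono fun ω => ?_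
  have hmono := fun f j => (A.strategy ω).monotone_outputProbWithin (M f) y j []
  have : K * ∑ g, ∑ j ∈ T, ⨆ d : ℕ, (A.strategy ω).outputProbWithin (M g) y j d []
      = ⨆ d : ℕ, K * ∑ g, ∑ j ∈ T, (A.strategy ω).outputProbWithin (M g) y j d [] := by
    rw [← ENNReal.mul_iSup, ← ENNReal.finsetSum_iSup_of_monotone fun g a b hab =>
      Finset.sum_le_sum fun j _ => hmono g j hab]
    simp_rw [← ENNReal.finsetSum_iSup_of_monotone fun j => hmono _ j]
  dsimp only
  rw [this]
  refine iSup_le fun d => ((A.strategy ω).hiding_bound hM ht K T I F B free hfree hcount d).trans ?_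
  gcongr
  · exact le_iSup (fun d : ℕ => (A.strategy ω).outputProbWithin _ y _ d []) d
  · exact le_iSup (fun d : ℕ => (A.strategy ω).expectedQueriesWithin _ y d []) d

/-! ### The Boolean cube: characters and antiperiodic functions -/

/-- The sign `(-1) ^ b`. -/
def boolSign (b : Bool) : ℝ := if b then -1 else 1

lemma boolSign_mul_self (b : Bool) : boolSign b * boolSign b = 1 := by
  cases b <;> simp [boolSign]

lemma boolSign_not (b : Bool) : boolSign (!b) = -boolSign b := by
  cases b <;> simp [boolSign]

/-- Addition in the cube `𝔽₂ ^ k`. -/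
def cubeAdd {k : ℕ} (x s : Fin k → Bool) : Fin k → Bool := fun i => xor (x i) (s i)

lemma cubeAdd_cubeAdd {k : ℕ} (x s : Fin k → Bool) : cubeAdd (cubeAdd x s) s = x := by
  funext i
  simp [cubeAdd]

/-- The character `(-1) ^ (s ⬝ y)` of the cube. -/
def cubeChar {k : ℕ} (s y : Fin k → Bool) : ℝ := ∏ i, if s i && y i then -1 else 1

lemma cubeChar_eq_or {k : ℕ} (s y : Fin k → Bool) : cubeChar s y = 1 ∨ cubeChar s y = -1 := by
  unfold cubeChar
  refine Finset.prod_induction _ (fun r : ℝ => r = 1 ∨ r = -1) ?_ (Or.inl rfl) ?_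
  · rintro a b (rfl | rfl) (rfl | rfl) <;> simp
  · intro i _
    split_ifs <;> simp

/-- At least half of all shifts are orthogonal to `y`. -/
lemma two_pow_le_card_cubeChar_eq_one {k : ℕ} (y : Fin k → Bool) :
    2 ^ k ≤ 2 * (Finset.univ.filter fun s : Fin k → Bool => cubeChar s y = 1).card := by
  have hsum : 0 ≤ ∑ s : Fin k → Bool, cubeChar s y := by
    have := Fintype.prod_sum fun (i : Fin k) (b : Bool) => if b && y i then (-1 : ℝ) else 1
    unfold cubeChar
    rw [← this]
    refine Finset.prod_nonneg fun i _ => ?_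
    cases y i <;> simp
  have hsplit : ∑ s : Fin k → Bool, cubeChar s y
      = ∑ s : Fin k → Bool, (2 * (if cubeChar s y = 1 then (1 : ℝ) else 0) - 1) := by
    refine Finset.sum_congr rfl fun s _ => ?_
    rcases cubeChar_eq_or s y with h | h <;> norm_num [h]
  rw [hsplit, Finset.sum_sub_distrib, ← Finset.mul_sum, Finset.sum_boole] at hsum
  simp only [Finset.sum_const, Finset.card_univ, nsmul_eq_mul, mul_one, Fintype.card_pi,
    Fintype.card_bool, Finset.prod_const, Fintype.card_fin] at hsum
  have : ((2 ^ k : ℕ) : ℝ)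
      ≤ 2 * (Finset.univ.filter fun s : Fin k → Bool => cubeChar s y = 1).card := by linarith
  exact_mod_cast this

/-- The function with `f (x + s) = !f x` that agrees with `g` on the half of the cube where the
coordinate `i` is `false`; the coordinate `i` should satisfy `s i = true`. -/
def antiperiodize {k : ℕ} (s : Fin k → Bool) (i : Fin k) (g : (Fin k → Bool) → Bool) :
    (Fin k → Bool) → Bool :=
  fun x => if x i then !g (cubeAdd x s) else g x

lemma antiperiodize_cubeAdd {k : ℕ} {s : Fin k → Bool} {i : Fin k} (hi : s i = true)
    (g : (Fin k → Bool) → Bool) (x : Fin k → Bool) :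
    antiperiodize s i g (cubeAdd x s) = !antiperiodize s i g x := by
  have : cubeAdd x s i = !x i := by simp [cubeAdd, hi]
  unfold antiperiodize
  rw [this, cubeAdd_cubeAdd]
  cases x i <;> simp

/-- On a list of points no two of which differ by `s`, a random antiperiodic function has the same
distribution as a random function. -/
lemma sum_consistent_antiperiodize {k : ℕ} {s : Fin k → Bool} {i : Fin k}
    (Q : List ((Fin k → Bool) × Bool))
    (hQ : ∀ p ∈ Q, ∀ q ∈ Q, q.1 ≠ cubeAdd p.1 s) :
    ∑ g, consistent Q g = ∑ g, consistent Q (antiperiodize s i g) := by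
  classical
  -- `sw` selects the pairs `{y, y + s}` whose listed member is not the representative; swapping
  -- the values of `g` on these pairs, up to sign, is an involution.
  let sw : (Fin k → Bool) → Bool := fun y =>
    decide (∃ p ∈ Q, p.1 i = true ∧ (p.1 = y ∨ p.1 = cubeAdd y s))
  have hsw : ∀ y, sw (cubeAdd y s) = sw y := by
    intro y
    simp only [sw, cubeAdd_cubeAdd]
    congr! 5
    exact or_comm
  let Θ : ((Fin k → Bool) → Bool) → (Fin k → Bool) → Bool := fun g y =>
    if sw y then !g (cubeAdd y s) else g y
  have hΘ : Function.Involutive Θ := by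
    intro g
    funext y
    simp only [Θ, hsw, cubeAdd_cubeAdd]
    cases sw y <;> simp
  have hval : ∀ g, ∀ p ∈ Q, antiperiodize s i (Θ g) p.1 = g p.1 := by
    intro g p hp
    cases hpi : p.1 i with
    | true =>
      have : sw p.1 = true := by
        simp only [sw, decide_eq_true_eq]
        exact ⟨p, hp, hpi, Or.inl rfl⟩
      simp [antiperiodize, hpi, Θ, hsw, this, cubeAdd_cubeAdd]
    | false =>
      have : sw p.1 = false := by
        simp only [sw, decide_eq_false_iff_not]
        rintro ⟨q, hq, hqi, h | h⟩
        · rw [h, hpi] at hqi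
          exact Bool.false_ne_true hqi
        · exact hQ p hp q hq h
      simp [antiperiodize, hpi, Θ, this]
  rw [← Equiv.sum_comp hΘ.toPerm fun g => consistent Q (antiperiodize s i g)]
  refine Finset.sum_congr rfl fun g _ => ?_
  unfold consistent
  congr 1
  exact propext (forall₂_congr fun p hp => by
    rw [Function.Involutive.coe_toPerm, hval g p hp])

/-- A list of at most `t` points excludes at most `t ^ 2` shifts, so enough shifts remain that
are orthogonal to `y`. -/
lemma card_orthogonal_free_shifts {k t : ℕ} (y : Fin k → Bool) (Q : List ((Fin k → Bool) × Bool))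
    (hQ : Q.length ≤ t) :
    2 ^ k ≤ 2 * ((open scoped Classical in Finset.univ.filter fun s : Fin k → Bool =>
      (s ≠ fun _ => false) ∧ cubeChar s y = 1 ∧ ∀ p ∈ Q, ∀ q ∈ Q, q.1 ≠ cubeAdd p.1 s).card
        + t ^ 2 + 1) := by
  classical
  set G := Finset.univ.filter fun s : Fin k → Bool =>
      (s ≠ fun _ => false) ∧ cubeChar s y = 1 ∧ ∀ p ∈ Q, ∀ q ∈ Q, q.1 ≠ cubeAdd p.1 s with hG
  let P : Finset (Fin k → Bool) := (Q.map Prod.fst).toFinset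
  have hP : P.card ≤ t := (List.toFinset_card_le _).trans (by simpa using hQ)
  let C : Finset (Fin k → Bool) := (P ×ˢ P).image fun z => cubeAdd z.1 z.2
  have hC : C.card ≤ t ^ 2 := by
    refine Finset.card_image_le.trans ?_
    rw [Finset.card_product, sq]
    exact Nat.mul_le_mul hP hP
  have hsub : (Finset.univ.filter fun s : Fin k → Bool => cubeChar s y = 1)
      ⊆ (G ∪ C) ∪ {fun _ => false} := by
    intro s hs
    simp only [Finset.mem_filter, Finset.mem_univ, true_and] at hs
    by_contra hn
    simp only [Finset.mem_union, Finset.mem_singleton, not_or] at hn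
    obtain ⟨⟨hnG, hnC⟩, hn0⟩ := hn
    refine hnG (by
      simp only [hG, Finset.mem_filter, Finset.mem_univ, true_and]
      refine ⟨hn0, hs, fun p hp q hq h => hnC ?_⟩
      refine Finset.mem_image.mpr ⟨(p.1, q.1), ?_, ?_⟩
      · simp only [P, Finset.mem_product, List.mem_toFinset, List.mem_map]
        exact ⟨⟨p, hp, rfl⟩, ⟨q, hq, rfl⟩⟩
      · funext i
        simp [h, cubeAdd])
  have h1 := Finset.card_le_card hsub
  have h2 := Finset.card_union_le (G ∪ C) {fun _ => false}
  have h3 := Finset.card_union_le G C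
  rw [Finset.card_singleton] at h2
  have h4 := two_pow_le_card_cubeChar_eq_one y
  omega

/-! ### The quantum circuit -/

/-- Negation of the bit `i`. -/
def flipBit {k : ℕ} (x : Fin k → Bool) (i : Fin k) : Fin k → Bool := Function.update x i (!x i)

lemma flipBit_flipBit {k : ℕ} (x : Fin k → Bool) (i : Fin k) : flipBit (flipBit x i) i = x := by
  simp [flipBit]

lemma flipBit_apply_self {k : ℕ} (x : Fin k → Bool) (i : Fin k) : flipBit x i i = !x i := by
  simp [flipBit]

lemma flipBit_apply_of_ne {k : ℕ} (x : Fin k → Bool) {i j : Fin k} (h : j ≠ i) :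
    flipBit x i j = x j := by
  simp [flipBit, h]

/-- The Hadamard gate on the bit `i`. -/
noncomputable def hadamardGate {k : ℕ} (i : Fin k) : Matrix (Fin k → Bool) (Fin k → Bool) ℝ :=
  Matrix.of fun x x' =>
    (√2)⁻¹ * ((if x' = flipBit x i then 1 else 0) + if x' = x then boolSign (x i) else 0)

/-- The sign oracle for `f`. -/
noncomputable def signGate {k : ℕ} (f : (Fin k → Bool) → Bool) :
    Matrix (Fin k → Bool) (Fin k → Bool) ℝ :=
  Matrix.diagonal fun x => boolSign (f x)

/-- The gate applied at time `t ≤ 2 * k`: Hadamard gates on the bits `0, …, k - 1`, the sign oracle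
at time `k`, and Hadamard gates on the bits `k - 1, …, 0`. The order makes the circuit a
palindrome. -/
noncomputable def circuitGate {k : ℕ} (f : (Fin k → Bool) → Bool) (t : ℕ) :
    Matrix (Fin k → Bool) (Fin k → Bool) ℝ :=
  if h : min t (2 * k - t) < k then hadamardGate ⟨_, h⟩ else signGate f

/-- The state of the circuit at time `t`. -/
noncomputable def circuitState {k : ℕ} (f : (Fin k → Bool) → Bool) : ℕ → (Fin k → Bool) → ℝ
  | 0 => fun x => if x = fun _ => false then 1 else 0
  | t + 1 => (circuitGate f t).mulVec (circuitState f t)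

lemma hadamardGate_mulVec {k : ℕ} (i : Fin k) (ψ : (Fin k → Bool) → ℝ) (x : Fin k → Bool) :
    (hadamardGate i).mulVec ψ x = (√2)⁻¹ * (ψ (flipBit x i) + boolSign (x i) * ψ x) := by
  simp [hadamardGate, Matrix.mulVec, dotProduct, mul_assoc, ← Finset.mul_sum, add_mul,
    Finset.sum_add_distrib]

lemma signGate_mulVec {k : ℕ} (f : (Fin k → Bool) → Bool) (ψ : (Fin k → Bool) → ℝ)
    (x : Fin k → Bool) : (signGate f).mulVec ψ x = boolSign (f x) * ψ x := by
  simp [signGate, Matrix.mulVec_diagonal]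

lemma inv_sqrt_two_sq : ((√2)⁻¹ : ℝ) ^ 2 = 1 / 2 := by
  rw [inv_pow, Real.sq_sqrt (by norm_num)]
  norm_num

lemma sum_sq_hadamardGate_mulVec {k : ℕ} (i : Fin k) (ψ : (Fin k → Bool) → ℝ) :
    ∑ x, (hadamardGate i).mulVec ψ x ^ 2 = ∑ x, ψ x ^ 2 := by
  have hflip : ∀ φ : (Fin k → Bool) → ℝ, ∑ x, φ (flipBit x i) = ∑ x, φ x := fun φ =>
    Equiv.sum_comp (Function.Involutive.toPerm (fun x : Fin k → Bool => flipBit x i)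
      fun x => flipBit_flipBit x i) φ
  have h : ∑ x, ((hadamardGate i).mulVec ψ x ^ 2 + (hadamardGate i).mulVec ψ (flipBit x i) ^ 2)
      = ∑ x, (ψ x ^ 2 + ψ (flipBit x i) ^ 2) := by
    refine Finset.sum_congr rfl fun x _ => ?_
    rw [hadamardGate_mulVec, hadamardGate_mulVec, flipBit_flipBit, flipBit_apply_self,
      boolSign_not, mul_pow, mul_pow, inv_sqrt_two_sq]
    have := boolSign_mul_self (x i)
    linear_combination (1 / 2 * (ψ x ^ 2 + ψ (flipBit x i) ^ 2)) * this
  rw [Finset.sum_add_distrib, Finset.sum_add_distrib,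
    hflip fun x => (hadamardGate i).mulVec ψ x ^ 2, hflip fun x => ψ x ^ 2] at h
  linarith

lemma sum_sq_circuitGate_mulVec {k : ℕ} (f : (Fin k → Bool) → Bool) (t : ℕ)
    (ψ : (Fin k → Bool) → ℝ) : ∑ x, (circuitGate f t).mulVec ψ x ^ 2 = ∑ x, ψ x ^ 2 := by
  unfold circuitGate
  split_ifs
  · exact sum_sq_hadamardGate_mulVec _ ψ
  · refine Finset.sum_congr rfl fun x _ => ?_
    rw [signGate_mulVec, mul_pow, sq (boolSign _), boolSign_mul_self, one_mul]

lemma sum_sq_circuitState {k : ℕ} (f : (Fin k → Bool) → Bool) (t : ℕ) :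
    ∑ x, circuitState f t x ^ 2 = 1 := by
  induction t with
  | zero => simp [circuitState]
  | succ t ih => rw [circuitState, sum_sq_circuitGate_mulVec, ih]

lemma circuitState_of_le {k : ℕ} (f : (Fin k → Bool) → Bool) (t : ℕ) (ht : t ≤ k)
    (x : Fin k → Bool) : circuitState f t x
      = if ∀ i : Fin k, t ≤ i → x i = false then ((√2)⁻¹ : ℝ) ^ t else 0 := by
  induction t generalizing x with
  | zero => simp [circuitState, funext_iff]
  | succ t ih =>
    have hlt : min t (2 * k - t) < k := by omega
    have hgate : circuitGate f t = hadamardGate ⟨t, ht⟩ := by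
      rw [circuitGate, dif_pos hlt]
      congr
      omega
    rw [circuitState, hgate, hadamardGate_mulVec, ih (by omega), ih (by omega)]
    set i : Fin k := ⟨t, ht⟩ with hi
    have hrest : ∀ z : Fin k → Bool, (∀ j : Fin k, t ≤ j → z j = false)
        ↔ z i = false ∧ ∀ j : Fin k, t + 1 ≤ j → z j = false := by
      intro z
      refine ⟨fun h => ⟨h i le_rfl, fun j hj => h j (by omega)⟩, fun h j hj => ?_⟩
      rcases hj.eq_or_lt with e | e
      · have : j = i := Fin.ext e.symm
        rw [this, h.1]
      · exact h.2 j e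
    have hflip : (∀ j : Fin k, t + 1 ≤ j → flipBit x i j = false)
        ↔ ∀ j : Fin k, t + 1 ≤ j → x j = false := by
      refine forall₂_congr fun j hj => ?_
      rw [flipBit_apply_of_ne]
      rintro rfl
      simp [hi] at hj
    rw [if_congr (hrest _) rfl rfl, if_congr (hrest x) rfl rfl, flipBit_apply_self,
      if_congr (and_congr Iff.rfl hflip) rfl rfl]
    cases hx : x i <;> simp [boolSign, pow_succ, mul_comm]

lemma cubeChar_flipBit {k : ℕ} {a : Fin k → Bool} {i : Fin k} (ha : a i = false)
    (x : Fin k → Bool) : cubeChar a (flipBit x i) = cubeChar a x := by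
  unfold cubeChar
  refine Finset.prod_congr rfl fun j _ => ?_
  by_cases hj : j = i
  · simp [hj, ha]
  · rw [flipBit_apply_of_ne x hj]

lemma cubeChar_update_true {k : ℕ} {a : Fin k → Bool} {i : Fin k} (ha : a i = false)
    (x : Fin k → Bool) :
    cubeChar (Function.update a i true) x = boolSign (x i) * cubeChar a x := by
  unfold cubeChar
  rw [← Finset.mul_prod_erase _ _ (Finset.mem_univ i),
    ← Finset.mul_prod_erase Finset.univ (fun j => if a j && x j then (-1 : ℝ) else 1)
      (Finset.mem_univ i)]
  simp only [Function.update_self, Bool.true_and, ha, Bool.false_and, Bool.false_eq_true,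
    if_false, one_mul, boolSign]
  congr 1
  refine Finset.prod_congr rfl fun j hj => ?_
  rw [Function.update_of_ne (Finset.ne_of_mem_erase hj)]

lemma flipBit_cubeAdd {k : ℕ} (x b : Fin k → Bool) (i : Fin k) :
    flipBit (cubeAdd x b) i = cubeAdd (flipBit x i) b := by
  funext j
  by_cases hj : j = i
  · subst hj
    simp [flipBit, cubeAdd]
  · simp [flipBit, cubeAdd, hj]

lemma cubeAdd_update_false {k : ℕ} {x b : Fin k → Bool} {i : Fin k} (hb : b i = true) :
    cubeAdd x (Function.update b i false) = cubeAdd (flipBit x i) b := by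
  funext j
  by_cases hj : j = i
  · subst hj
    simp [flipBit, cubeAdd, hb]
  · simp [flipBit, cubeAdd, hj]

/-- A Hadamard gate turns the bit `i` of a shift into the bit `i` of a phase. -/
lemma hadamardGate_shift_phase {k : ℕ} (i : Fin k) {a b : Fin k → Bool} (ha : a i = false)
    {ψ : (Fin k → Bool) → ℝ} (hψ : ∀ x, cubeChar a x * ψ (cubeAdd x b) = -ψ x)
    (x : Fin k → Bool) :
    cubeChar (Function.update a i (b i)) x *
        (hadamardGate i).mulVec ψ (cubeAdd x (Function.update b i false))
      = -(hadamardGate i).mulVec ψ x := by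
  have h1 := hψ x
  have h2 := hψ (flipBit x i)
  rw [cubeChar_flipBit ha] at h2
  rw [hadamardGate_mulVec, hadamardGate_mulVec]
  cases hb : b i with
  | false =>
    have e1 : Function.update a i false = a := by rw [← ha, Function.update_eq_self]
    have e2 : Function.update b i false = b := by rw [← hb, Function.update_eq_self]
    have e3 : cubeAdd x b i = x i := by simp [cubeAdd, hb]
    rw [e1, e2, flipBit_cubeAdd, e3]
    linear_combination (√2)⁻¹ * h2 + (√2)⁻¹ * boolSign (x i) * h1
  | true =>
    have e3 : cubeAdd (flipBit x i) b i = x i := by simp [cubeAdd, hb, flipBit]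
    rw [cubeChar_update_true ha, cubeAdd_update_false hb, flipBit_cubeAdd, flipBit_flipBit, e3]
    have h3 := boolSign_mul_self (x i)
    linear_combination (√2)⁻¹ * boolSign (x i) * h1 + (√2)⁻¹ * h2
      + (√2)⁻¹ * cubeChar a x * ψ (cubeAdd (flipBit x i) b) * h3

/-- If `f (x + s) = !f x`, the circuit for `f` never outputs a `y` orthogonal to `s`. -/
lemma circuitState_final_eq_zero {k : ℕ} {f : (Fin k → Bool) → Bool} {s : Fin k → Bool}
    (hf : ∀ x, f (cubeAdd x s) = !f x) {y : Fin k → Bool} (hy : cubeChar s y = 1) :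
    circuitState f (2 * k + 1) y = 0 := by
  -- After the Hadamard gates on the bits `≥ p`, those bits of `s` act as a phase and the others
  -- still act as a shift.
  have key : ∀ j p : ℕ, p + j = k → ∀ x,
      cubeChar (fun i => s i && decide (p ≤ (i : ℕ))) x *
        circuitState f (2 * k + 1 - p) (cubeAdd x fun i => s i && decide ((i : ℕ) < p))
      = -circuitState f (2 * k + 1 - p) x := by
    intro j
    induction j with
    | zero =>
      intro p hp x
      obtain rfl : p = k := by omega
      have e0 : 2 * p + 1 - p = p + 1 := by omega
      have e1 : (fun i : Fin p => s i && decide (p ≤ (i : ℕ))) = fun _ => false := by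
        funext i
        simp
      have e2 : (fun i : Fin p => s i && decide ((i : ℕ) < p)) = s := by
        funext i
        simp
      have hgate : circuitGate f p = signGate f := dif_neg (by omega)
      have hconst : ∀ z, circuitState f p z = ((√2)⁻¹ : ℝ) ^ p := fun z => by
        rw [circuitState_of_le f p le_rfl, if_pos fun i hi => absurd i.2 (by omega)]
      rw [e0, e1, e2, circuitState, hgate, signGate_mulVec, signGate_mulVec, hconst, hconst, hf,
        boolSign_not]
      simp [cubeChar]
    | succ j ih =>
      intro p hp x
      have hpk : p < k := by omega
      have ih' := ih (p + 1) (by omega)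
      have e0 : 2 * k + 1 - (p + 1) = 2 * k - p := by omega
      have e0' : 2 * k + 1 - p = 2 * k - p + 1 := by omega
      rw [e0] at ih'
      have hlt : min (2 * k - p) (2 * k - (2 * k - p)) < k := by omega
      have hgate : circuitGate f (2 * k - p) = hadamardGate ⟨p, hpk⟩ := by
        rw [circuitGate, dif_pos hlt]
        congr
        omega
      have := hadamardGate_shift_phase ⟨p, hpk⟩ (by simp) ih' x
      rw [e0', circuitState, hgate]
      convert this using 3
      · funext i
        by_cases hi : i = ⟨p, hpk⟩
        · subst hi
          simp
        · have : (i : ℕ) ≠ p := fun h => hi (Fin.ext h)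
          rw [Function.update_of_ne hi]
          congr 2
          simp only [eq_iff_iff]
          omega
      · congr 1
        funext i
        by_cases hi : i = ⟨p, hpk⟩
        · subst hi
          simp
        · have : (i : ℕ) ≠ p := fun h => hi (Fin.ext h)
          rw [Function.update_of_ne hi]
          congr 2
          simp only [eq_iff_iff]
          omega
  have h0 := key k 0 (by omega) y
  have e1 : (fun i : Fin k => s i && decide (0 ≤ (i : ℕ))) = s := by
    funext i
    simp
  have e2 : cubeAdd y (fun i : Fin k => s i && decide ((i : ℕ) < 0)) = y := by
    funext i
    simp [cubeAdd]
  rw [e1, e2, hy] at h0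
  simp only [Nat.sub_zero, one_mul] at h0
  linarith

/-! ### The history matrix of the circuit -/

/-- Rows and columns of the history matrix: pairs of a time and a basis state, and `r` padding
indices. -/
abbrev HistoryIndex (k r : ℕ) : Type := (Fin (2 * k + 2) × (Fin k → Bool)) ⊕ Fin r

/-- The time-reversed history matrix `J (1 - L)`, where `L = ∑ t, |t + 1⟩⟨t| ⊗ circuitGate f t` and
`J` maps time `t` to `2 * k + 1 - t`, extended by an identity block. It is symmetric because the
circuit is a palindrome of symmetric gates. -/
noncomputable def historyMatrix {k : ℕ} (r : ℕ) (f : (Fin k → Bool) → Bool) :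
    Matrix (HistoryIndex k r) (HistoryIndex k r) ℝ :=
  Matrix.of fun a b => match a, b with
    | .inl (t, x), .inl (t', x') =>
      (if (t : ℕ) + t' = 2 * k + 1 ∧ x' = x then 1 else 0)
        - if (t : ℕ) + t' = 2 * k then circuitGate f t' x x' else 0
    | .inr i, .inr j => if j = i then 1 else 0
    | _, _ => 0

lemma circuitGate_symm {k : ℕ} (f : (Fin k → Bool) → Bool) {t t' : ℕ} (h : t + t' = 2 * k)
    (x x' : Fin k → Bool) : circuitGate f t x x' = circuitGate f t' x' x := by
  have e : circuitGate f t' = circuitGate f t := by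
    have : min t' (2 * k - t') = min t (2 * k - t) := by omega
    simp only [circuitGate, this]
  rw [e]
  unfold circuitGate
  split_ifs with hi
  · set i : Fin k := ⟨_, hi⟩
    have h1 : x' = flipBit x i ↔ x = flipBit x' i :=
      ⟨fun h => by rw [h, flipBit_flipBit], fun h => by rw [h, flipBit_flipBit]⟩
    simp only [hadamardGate, Matrix.of_apply, h1]
    by_cases hx : x = x'
    · simp [hx]
    · simp [hx, Ne.symm hx]
  · simp only [signGate, Matrix.diagonal_apply]
    by_cases hx : x = x'
    · simp [hx]
    · simp [hx, Ne.symm hx]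

lemma historyMatrix_isSymm {k r : ℕ} (f : (Fin k → Bool) → Bool) :
    (historyMatrix r f).IsSymm := by
  refine Matrix.IsSymm.ext ?_
  rintro (⟨t, x⟩ | i) (⟨t', x'⟩ | j)
  · simp only [historyMatrix, Matrix.of_apply, add_comm (t' : ℕ) t, eq_comm (a := x)]
    congr 1
    split_ifs with h
    · exact circuitGate_symm f (by omega) _ _
    · rfl
  · rfl
  · rfl
  · simp [historyMatrix, eq_comm]

lemma exists_circuitGate_support {k : ℕ} (f : (Fin k → Bool) → Bool) (t : ℕ)
    (x : Fin k → Bool) : ∃ z, ∀ x', circuitGate f t x x' ≠ 0 → x' = x ∨ x' = z := by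
  unfold circuitGate
  split_ifs with h
  · refine ⟨flipBit x ⟨_, h⟩, fun x' hx' => ?_⟩
    by_contra hn
    rw [not_or] at hn
    simp [hadamardGate, hn.1, hn.2] at hx'
  · refine ⟨x, fun x' hx' => ?_⟩
    by_contra hn
    rw [not_or] at hn
    exact hx' (Matrix.diagonal_apply_ne _ (Ne.symm hn.1))

lemma ncard_historyMatrix_row_le {k r : ℕ} (f : (Fin k → Bool) → Bool) (a : HistoryIndex k r) :
    {b | historyMatrix r f a b ≠ 0}.ncard ≤ 3 := by
  rcases a with ⟨t, x⟩ | i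
  · obtain ⟨z, hz⟩ := exists_circuitGate_support f (2 * k - t) x
    refine (Set.ncard_le_ncard (t := {Sum.inl (t.rev, x),
      Sum.inl (⟨2 * k - t, by omega⟩, x), Sum.inl (⟨2 * k - t, by omega⟩, z)}) ?_
      (Set.toFinite _)).trans
      ((Set.ncard_insert_le _ _).trans
        (Nat.succ_le_succ ((Set.ncard_insert_le _ _).trans (by simp))))
    rintro (⟨t', x'⟩ | j) hb
    · simp only [historyMatrix, Set.mem_ofPred_eq, Matrix.of_apply] at hb
      simp only [Set.mem_insert_iff, Set.mem_singleton_iff, Sum.inl.injEq, Prod.mk.injEq]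
      by_cases h1 : (t : ℕ) + t' = 2 * k + 1 ∧ x' = x
      · refine Or.inl ⟨Fin.ext ?_, h1.2⟩
        rw [Fin.val_rev]
        omega
      · by_cases h2 : (t : ℕ) + t' = 2 * k
        · have h3 : (t' : ℕ) = 2 * k - t := by omega
          rw [if_neg h1, if_pos h2, zero_sub, neg_ne_zero, h3] at hb
          rcases hz x' hb with h | h
          · exact Or.inr (Or.inl ⟨Fin.ext h3, h⟩)
          · exact Or.inr (Or.inr ⟨Fin.ext h3, h⟩)
        · rw [if_neg h1, if_neg h2] at hb
          simp at hb
    · exact absurd rfl hb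
  · refine (Set.ncard_le_ncard (t := {Sum.inr i}) ?_ (Set.toFinite _)).trans (by simp)
    rintro (⟨t', x'⟩ | j) hb
    · exact absurd rfl hb
    · simp only [historyMatrix, Set.mem_ofPred_eq, Matrix.of_apply] at hb
      simp only [Set.mem_singleton_iff, Sum.inr.injEq]
      by_contra hn
      simp [hn] at hb

lemma circuitGate_congr {k : ℕ} {f f' : (Fin k → Bool) → Bool} {x : Fin k → Bool}
    (h : f x = f' x) (t : ℕ) (x' : Fin k → Bool) :
    circuitGate f t x x' = circuitGate f' t x x' := by
  unfold circuitGate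
  split_ifs
  · rfl
  · simp only [signGate, Matrix.diagonal_apply, h]

lemma historyMatrix_congr {k r : ℕ} {f f' : (Fin k → Bool) → Bool} {a : HistoryIndex k r}
    (h : ∀ t x, a = .inl (t, x) → f x = f' x) (b : HistoryIndex k r) :
    historyMatrix r f a b = historyMatrix r f' a b := by
  rcases a with ⟨t, x⟩ | i <;> rcases b with ⟨t', x'⟩ | j
  · simp only [historyMatrix, Matrix.of_apply, circuitGate_congr (h t x rfl)]
  · rfl
  · rfl
  · rfl

lemma sq_circuitGate {k : ℕ} (f f' : (Fin k → Bool) → Bool) (t : ℕ) (x x' : Fin k → Bool) :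
    circuitGate f t x x' ^ 2 = circuitGate f' t x x' ^ 2 := by
  unfold circuitGate
  split_ifs
  · rfl
  · simp only [signGate, Matrix.diagonal_apply]
    split_ifs
    · rw [sq, sq, boolSign_mul_self, boolSign_mul_self]
    · rfl

lemma sq_historyMatrix {k r : ℕ} (f f' : (Fin k → Bool) → Bool) (a b : HistoryIndex k r) :
    historyMatrix r f a b ^ 2 = historyMatrix r f' a b ^ 2 := by
  rcases a with ⟨t, x⟩ | i <;> rcases b with ⟨t', x'⟩ | j
  · simp only [historyMatrix, Matrix.of_apply]
    by_cases h : (t : ℕ) + t' = 2 * k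
    · rw [if_neg (by omega), if_pos h, if_pos h, zero_sub, zero_sub, neg_sq, neg_sq]
      exact sq_circuitGate f f' _ _ _
    · rw [if_neg h, if_neg h]
  · rfl
  · rfl
  · rfl

/-! ### The action of the history matrix on histories -/

/-- The state at time `t` of a history, `0` for times out of range. -/
def historyState {k r : ℕ} (u : HistoryIndex k r → ℝ) (t : ℕ) : (Fin k → Bool) → ℝ :=
  fun x => if h : t < 2 * k + 2 then u (.inl (⟨t, h⟩, x)) else 0

/-- The failure of a history to follow the circuit in the step that leads to time `t`. -/
noncomputable def historyDefect {k r : ℕ} (f : (Fin k → Bool) → Bool) (u : HistoryIndex k r → ℝ) :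
    ℕ → (Fin k → Bool) → ℝ
  | 0 => historyState u 0
  | t + 1 => historyState u (t + 1) - (circuitGate f t).mulVec (historyState u t)

lemma historyMatrix_mulVec_inl {k r : ℕ} (f : (Fin k → Bool) → Bool) (u : HistoryIndex k r → ℝ)
    (t : Fin (2 * k + 2)) (x : Fin k → Bool) :
    (historyMatrix r f).mulVec u (.inl (t.rev, x)) = historyDefect f u t x := by
  have h1 : ∀ t' : Fin (2 * k + 2), (t.rev : ℕ) + t' = 2 * k + 1 ↔ t' = t := by
    intro t'
    rw [Fin.val_rev, Fin.ext_iff]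
    omega
  have h2 : ∀ t' : Fin (2 * k + 2), (t.rev : ℕ) + t' = 2 * k ↔ (t' : ℕ) + 1 = t := by
    intro t'
    rw [Fin.val_rev]
    omega
  have hstart : ∑ t', ∑ x', (if t' = t ∧ x' = x then (1 : ℝ) else 0) * u (.inl (t', x'))
      = historyState u t x := by
    simp [historyState, ite_and]
  simp only [Matrix.mulVec, dotProduct, Fintype.sum_sum_type, Fintype.sum_prod_type,
    historyMatrix, Matrix.of_apply, zero_mul, Finset.sum_const_zero, add_zero, h1, h2, sub_mul,
    Finset.sum_sub_distrib, hstart]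
  rcases t with ⟨t, ht⟩
  cases t with
  | zero => simp [historyDefect]
  | succ t =>
    simp only [historyDefect, Pi.sub_apply, Nat.add_right_cancel_iff]
    congr 1
    rw [Finset.sum_eq_single ⟨t, by omega⟩ (fun t' _ hne => by
      have : (t' : ℕ) ≠ t := fun h => hne (Fin.ext h)
      simp [this]) (by simp)]
    simp [Matrix.mulVec, dotProduct, historyState, show t < 2 * k + 2 by omega]

lemma historyMatrix_mulVec_inr {k r : ℕ} (f : (Fin k → Bool) → Bool) (u : HistoryIndex k r → ℝ)
    (i : Fin r) : (historyMatrix r f).mulVec u (.inr i) = u (.inr i) := by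
  simp [Matrix.mulVec, dotProduct, historyMatrix]

lemma sum_sq_history {k r : ℕ} (u : HistoryIndex k r → ℝ) :
    ∑ a, u a ^ 2 = ∑ t ∈ Finset.range (2 * k + 2), ∑ x, historyState u t x ^ 2
      + ∑ i, u (.inr i) ^ 2 := by
  rw [Fintype.sum_sum_type, Fintype.sum_prod_type,
    ← Fin.sum_univ_eq_sum_range fun t => ∑ x, historyState u t x ^ 2]
  simp [historyState]

lemma sum_sq_historyMatrix_mulVec {k r : ℕ} (f : (Fin k → Bool) → Bool)
    (u : HistoryIndex k r → ℝ) :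
    ∑ a, (historyMatrix r f).mulVec u a ^ 2
      = ∑ t ∈ Finset.range (2 * k + 2), ∑ x, historyDefect f u t x ^ 2
        + ∑ i, u (.inr i) ^ 2 := by
  rw [Fintype.sum_sum_type, Fintype.sum_prod_type,
    ← Fin.sum_univ_eq_sum_range fun t => ∑ x, historyDefect f u t x ^ 2,
    ← Equiv.sum_comp Fin.revPerm]
  simp only [Fin.revPerm_apply, historyMatrix_mulVec_inl, historyMatrix_mulVec_inr]

lemma sum_sq_historyMatrix_mulVec_le {k r : ℕ} (f : (Fin k → Bool) → Bool)
    (u : HistoryIndex k r → ℝ) :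
    ∑ a, (historyMatrix r f).mulVec u a ^ 2 ≤ 2 ^ 2 * ∑ a, u a ^ 2 := by
  have hstep : ∀ t, ∑ x, historyDefect f u (t + 1) x ^ 2
      ≤ 2 * ∑ x, historyState u (t + 1) x ^ 2 + 2 * ∑ x, historyState u t x ^ 2 := by
    intro t
    rw [← sum_sq_circuitGate_mulVec f t (historyState u t), Finset.mul_sum, Finset.mul_sum,
      ← Finset.sum_add_distrib]
    refine Finset.sum_le_sum fun x _ => ?_
    simp only [historyDefect, Pi.sub_apply]
    nlinarith [sq_nonneg (historyState u (t + 1) x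
      + (circuitGate f t).mulVec (historyState u t) x)]
  have h1 := Finset.sum_le_sum fun t (_ : t ∈ Finset.range (2 * k + 1)) => hstep t
  rw [Finset.sum_add_distrib, ← Finset.mul_sum, ← Finset.mul_sum] at h1
  rw [sum_sq_historyMatrix_mulVec, sum_sq_history,
    Finset.sum_range_succ' (fun t => ∑ x, historyDefect f u t x ^ 2)]
  have h2 := Finset.sum_range_succ' (fun t => ∑ x, historyState u t x ^ 2) (2 * k + 1)
  have h3 := Finset.sum_range_succ (fun t => ∑ x, historyState u t x ^ 2) (2 * k + 1)
  have h4 : 0 ≤ ∑ x, historyState u (2 * k + 1) x ^ 2 :=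
    Finset.sum_nonneg fun x _ => sq_nonneg _
  have h5 : 0 ≤ ∑ i, u (.inr i) ^ 2 := Finset.sum_nonneg fun x _ => sq_nonneg _
  have h6 : 0 ≤ ∑ x, historyState u 0 x ^ 2 := Finset.sum_nonneg fun x _ => sq_nonneg _
  simp only [historyDefect] at h1 ⊢
  linarith

/-- Defects accumulate at most additively, because the gates are isometries. -/
lemma sum_sq_le_historyMatrix_mulVec {k r : ℕ} (f : (Fin k → Bool) → Bool)
    (u : HistoryIndex k r → ℝ) :
    ∑ a, u a ^ 2 ≤ (2 * k + 2 : ℝ) ^ 2 * ∑ a, (historyMatrix r f).mulVec u a ^ 2 := by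
  let N : ((Fin k → Bool) → ℝ) → ℝ := fun ψ => ‖(WithLp.toLp 2 ψ : EuclideanSpace ℝ _)‖
  have hN : ∀ ψ, N ψ ^ 2 = ∑ x, ψ x ^ 2 := fun ψ => EuclideanSpace.real_norm_sq_eq _
  have hN0 : ∀ ψ, 0 ≤ N ψ := fun ψ => norm_nonneg _
  have hgate : ∀ t ψ, N ((circuitGate f t).mulVec ψ) = N ψ := fun t ψ => by
    rw [← sq_eq_sq₀ (hN0 _) (hN0 _), hN, hN, sum_sq_circuitGate_mulVec]
  have hacc : ∀ t, N (historyState u t)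
      ≤ ∑ j ∈ Finset.range (t + 1), N (historyDefect f u j) := by
    intro t
    induction t with
    | zero => simp [historyDefect]
    | succ t ih =>
      have : historyState u (t + 1)
          = (circuitGate f t).mulVec (historyState u t) + historyDefect f u (t + 1) := by
        simp [historyDefect]
      rw [Finset.sum_range_succ]
      calc N (historyState u (t + 1))
          ≤ N ((circuitGate f t).mulVec (historyState u t)) + N (historyDefect f u (t + 1)) := by
            rw [this]
            exact norm_add_le (WithLp.toLp 2 _ : EuclideanSpace ℝ (Fin k → Bool)) _
        _ ≤ _ := by
            rw [hgate]
            exact add_le_add ih le_rfl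
  set D := ∑ t ∈ Finset.range (2 * k + 2), ∑ x, historyDefect f u t x ^ 2 with hD
  have hD0 : 0 ≤ D := Finset.sum_nonneg fun t _ => Finset.sum_nonneg fun x _ => sq_nonneg _
  have hstate : ∀ t ∈ Finset.range (2 * k + 2),
      ∑ x, historyState u t x ^ 2 ≤ (2 * k + 2 : ℝ) * D := by
    intro t ht
    rw [Finset.mem_range] at ht
    rw [← hN]
    calc N (historyState u t) ^ 2
        ≤ (∑ j ∈ Finset.range (t + 1), N (historyDefect f u j)) ^ 2 :=
          pow_le_pow_left₀ (hN0 _) (hacc t) 2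
      _ ≤ (Finset.range (t + 1)).card * ∑ j ∈ Finset.range (t + 1), N (historyDefect f u j) ^ 2 :=
          sq_sum_le_card_mul_sum_sq
      _ ≤ (2 * k + 2 : ℝ) * D := by
          rw [Finset.card_range]
          refine mul_le_mul ?_ ?_ (Finset.sum_nonneg fun _ _ => sq_nonneg _) (by positivity)
          · exact_mod_cast ht
          · simp only [hN, hD]
            exact Finset.sum_le_sum_of_subset_of_nonneg (Finset.range_mono ht)
              fun _ _ _ => Finset.sum_nonneg fun x _ => sq_nonneg _
  have hsum := Finset.sum_le_sum hstate
  rw [Finset.sum_const, Finset.card_range, nsmul_eq_mul] at hsum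
  rw [sum_sq_historyMatrix_mulVec, sum_sq_history, ← hD]
  have h5 : 0 ≤ ∑ i, u (.inr i) ^ 2 := Finset.sum_nonneg fun x _ => sq_nonneg _
  have h6 : (1 : ℝ) ≤ (2 * k + 2 : ℝ) ^ 2 := by
    have : (0 : ℝ) ≤ k := Nat.cast_nonneg k
    nlinarith
  have h7 := mul_le_mul_of_nonneg_right h6 h5
  push_cast at hsum
  nlinarith

/-- The history of the circuit, the solution of the linear system. -/
noncomputable def circuitHistory {k : ℕ} (r : ℕ) (f : (Fin k → Bool) → Bool) :
    HistoryIndex k r → ℝ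
  | .inl (t, x) => circuitState f t x
  | .inr _ => 0

lemma historyMatrix_mulVec_circuitHistory {k r : ℕ} (f : (Fin k → Bool) → Bool) :
    (historyMatrix r f).mulVec (circuitHistory r f)
      = Pi.single (.inl (Fin.last _, fun _ => false)) 1 := by
  have hstate : ∀ t < 2 * k + 2, historyState (circuitHistory r f) t = circuitState f t := by
    intro t ht
    funext x
    simp [historyState, ht, circuitHistory]
  funext a
  rcases a with ⟨t, x⟩ | i
  · obtain ⟨t, rfl⟩ := Fin.rev_surjective t
    rw [historyMatrix_mulVec_inl]
    rcases t with ⟨t, ht⟩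
    cases t with
    | zero =>
      have : Fin.rev (⟨0, ht⟩ : Fin (2 * k + 2)) = Fin.last _ := Fin.rev_zero _
      rw [this]
      simp [historyDefect, hstate, circuitState, Pi.single_apply]
    | succ t =>
      have : Fin.rev (⟨t + 1, ht⟩ : Fin (2 * k + 2)) ≠ Fin.last _ := by
        rw [Ne, Fin.ext_iff, Fin.val_rev, Fin.val_last]
        simp only
        omega
      simp only [historyDefect, Pi.sub_apply]
      rw [hstate _ ht, hstate _ (by omega), circuitState]
      simp [this]
  · rw [historyMatrix_mulVec_inr]
    simp [circuitHistory]

lemma sum_sq_circuitHistory {k r : ℕ} (f : (Fin k → Bool) → Bool) :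
    ∑ a, circuitHistory r f a ^ 2 = 2 * k + 2 := by
  rw [Fintype.sum_sum_type, Fintype.sum_prod_type]
  simp [circuitHistory, sum_sq_circuitState]

/-! ### Condition numbers and approximate solutions -/

lemma conditionNumber_le {n : ℕ} (hn : 0 < n) {M : Matrix (Fin n) (Fin n) ℝ} {a b : ℝ}
    (ha : 0 ≤ a) (hb : 0 < b) (hup : ∀ u, ∑ i, M.mulVec u i ^ 2 ≤ a ^ 2 * ∑ i, u i ^ 2)
    (hlow : ∀ u, ∑ i, u i ^ 2 ≤ b ^ 2 * ∑ i, M.mulVec u i ^ 2) :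
    conditionNumber M ≤ a * b := by
  set T := Matrix.toEuclideanLin M with hT
  have hσ : ∀ i < n, T.singularValues i ≤ a ∧ 1 ≤ b * T.singularValues i := by
    intro i hi
    obtain ⟨v, hv⟩ := (T.hasEigenvalue_adjoint_comp_self_sq_singularValues
      (n := i) (by simpa using hi)).exists_hasEigenvector
    have hv0 : 0 < ‖v‖ ^ 2 := by
      have := norm_pos_iff.mpr hv.2
      positivity
    have hTv : ‖T v‖ ^ 2 = T.singularValues i ^ 2 * ‖v‖ ^ 2 := by
      have h1 := hv.apply_eq_smul
      rw [← real_inner_self_eq_norm_sq, ← LinearMap.adjoint_inner_left,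
        ← real_inner_self_eq_norm_sq, ← real_inner_smul_left]
      congr 1
    have hnorm : ‖T v‖ ^ 2 = ∑ j, M.mulVec v.ofLp j ^ 2 := EuclideanSpace.real_norm_sq_eq _
    have h2 := hup v.ofLp
    have h3 := hlow v.ofLp
    rw [← hnorm, ← EuclideanSpace.real_norm_sq_eq, hTv] at h2 h3
    have hs := T.singularValues_nonneg i
    constructor
    · exact le_of_sq_le_sq (le_of_mul_le_mul_right h2 hv0) ha
    · have h4 : 1 * ‖v‖ ^ 2 ≤ (b * T.singularValues i) ^ 2 * ‖v‖ ^ 2 := by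
        rw [mul_pow]
        linarith
      refine le_of_sq_le_sq ?_ (by positivity)
      rw [one_pow]
      exact le_of_mul_le_mul_right h4 hv0
  obtain ⟨h1, -⟩ := hσ 0 hn
  obtain ⟨-, h2⟩ := hσ (n - 1) (by omega)
  have h3 : 0 < T.singularValues (n - 1) := by
    by_contra hc
    nlinarith
  rw [conditionNumber, div_le_iff₀ h3]
  nlinarith

lemma sum_sampleProb_eq {n : ℕ} (v : EuclideanSpace ℝ (Fin n)) (B : Finset (Fin n)) :
    ∑ j ∈ B, sampleProb v j = ENNReal.ofReal ((∑ j ∈ B, v j ^ 2) / ‖v‖ ^ 2) := by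
  rw [Finset.sum_div, ENNReal.ofReal_sum_of_nonneg fun _ _ => by positivity]
  rfl

lemma sum_sq_sub_le {n : ℕ} {x x' : EuclideanSpace ℝ (Fin n)} {ε : ℝ}
    (h : ‖x' - x‖ ≤ ε * ‖x‖) (B : Finset (Fin n)) :
    ∑ j ∈ B, (x' j - x j) ^ 2 ≤ ε ^ 2 * ‖x‖ ^ 2 := by
  calc ∑ j ∈ B, (x' j - x j) ^ 2 ≤ ∑ j, (x' j - x j) ^ 2 :=
        Finset.sum_le_sum_of_subset_of_nonneg (Finset.subset_univ _) fun _ _ _ => sq_nonneg _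
    _ = ‖x' - x‖ ^ 2 := by
        rw [EuclideanSpace.real_norm_sq_eq]
        rfl
    _ ≤ (ε * ‖x‖) ^ 2 := pow_le_pow_left₀ (norm_nonneg _) h 2
    _ = _ := mul_pow _ _ _

lemma sum_sampleProb_le_of_eq_zero {n : ℕ} {x x' : EuclideanSpace ℝ (Fin n)} {ε : ℝ}
    (hε : ε ≤ 1 / 2) (hx : x ≠ 0) (h : ‖x' - x‖ ≤ ε * ‖x‖) {B : Finset (Fin n)}
    (hB : ∀ j ∈ B, x j = 0) : ∑ j ∈ B, sampleProb x' j ≤ ENNReal.ofReal (4 * ε ^ 2) := by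
  have hx0 : 0 < ‖x‖ := norm_pos_iff.mpr hx
  have hx' : ‖x‖ / 2 ≤ ‖x'‖ := by
    have := norm_sub_norm_le x x'
    rw [norm_sub_rev] at this
    nlinarith
  have hnum : ∑ j ∈ B, x' j ^ 2 ≤ ε ^ 2 * ‖x‖ ^ 2 := by
    refine le_trans (le_of_eq ?_) (sum_sq_sub_le h B)
    exact Finset.sum_congr rfl fun j hj => by rw [hB j hj, sub_zero]
  rw [sum_sampleProb_eq]
  refine ENNReal.ofReal_le_ofReal ?_
  have hpos : 0 < ‖x'‖ := by linarith
  rw [div_le_iff₀ (by positivity)]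
  have : ‖x‖ ^ 2 ≤ 4 * ‖x'‖ ^ 2 := by nlinarith
  nlinarith [mul_le_mul_of_nonneg_left this (sq_nonneg ε)]

lemma le_sum_sampleProb {n : ℕ} {x x' : EuclideanSpace ℝ (Fin n)} {ε : ℝ} (hε : ε ≤ 1)
    (h : ‖x' - x‖ ≤ ε * ‖x‖) (hεx : ε ^ 2 * ‖x‖ ^ 2 ≤ 1 / 4) {B : Finset (Fin n)}
    (hB : ∑ j ∈ B, x j ^ 2 = 1) :
    ENNReal.ofReal (1 / (16 * ‖x‖ ^ 2)) ≤ ∑ j ∈ B, sampleProb x' j := by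
  have hx' : ‖x'‖ ≤ 2 * ‖x‖ := by
    have h1 := norm_sub_norm_le x' x
    have h2 := mul_le_mul_of_nonneg_right hε (norm_nonneg x)
    linarith
  have hnum : 1 / 4 ≤ ∑ j ∈ B, x' j ^ 2 := by
    have h1 := sum_sq_sub_le h B
    have h2 : ∑ j ∈ B, x j ^ 2 ≤ 2 * ∑ j ∈ B, x' j ^ 2 + 2 * ∑ j ∈ B, (x' j - x j) ^ 2 := by
      rw [Finset.mul_sum, Finset.mul_sum, ← Finset.sum_add_distrib]
      refine Finset.sum_le_sum fun j _ => ?_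
      nlinarith [sq_nonneg (2 * x' j - x j)]
    linarith
  have hle : ∑ j ∈ B, x' j ^ 2 ≤ ‖x'‖ ^ 2 := by
    rw [EuclideanSpace.real_norm_sq_eq]
    exact Finset.sum_le_sum_of_subset_of_nonneg (Finset.subset_univ _) fun _ _ _ => sq_nonneg _
  rw [sum_sampleProb_eq]
  refine ENNReal.ofReal_le_ofReal ?_
  have hsq : ‖x'‖ ^ 2 ≤ 4 * ‖x‖ ^ 2 := by nlinarith [norm_nonneg x']
  have hx'0 : 0 < ‖x'‖ ^ 2 := by linarith
  rw [div_le_div_iff₀ (by linarith) hx'0]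
  nlinarith

/-! ### The hard linear systems -/

/-- The history matrix as an `n × n` matrix. -/
noncomputable def hardMatrix {k r n : ℕ} (e : HistoryIndex k r ≃ Fin n)
    (f : (Fin k → Bool) → Bool) : Matrix (Fin n) (Fin n) ℝ :=
  (historyMatrix r f).submatrix e.symm e.symm

section HardMatrix

variable {k r n : ℕ} (e : HistoryIndex k r ≃ Fin n) (f : (Fin k → Bool) → Bool)

lemma hardMatrix_isSymm : (hardMatrix e f).IsSymm := (historyMatrix_isSymm f).submatrix _

lemma hardMatrix_mulVec (u : Fin n → ℝ) :
    (hardMatrix e f).mulVec u = (historyMatrix r f).mulVec (u ∘ e) ∘ e.symm :=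
  Matrix.submatrix_mulVec_equiv _ _ _ _

lemma sum_sq_hardMatrix_mulVec_le (u : Fin n → ℝ) :
    ∑ i, (hardMatrix e f).mulVec u i ^ 2 ≤ 2 ^ 2 * ∑ i, u i ^ 2 := by
  rw [hardMatrix_mulVec, ← Equiv.sum_comp e, ← Equiv.sum_comp e fun i => u i ^ 2]
  simpa using sum_sq_historyMatrix_mulVec_le f (u ∘ e)

lemma sum_sq_le_hardMatrix_mulVec (u : Fin n → ℝ) :
    ∑ i, u i ^ 2 ≤ (2 * k + 2 : ℝ) ^ 2 * ∑ i, (hardMatrix e f).mulVec u i ^ 2 := by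
  rw [hardMatrix_mulVec, ← Equiv.sum_comp e, ← Equiv.sum_comp e
    fun i => ((historyMatrix r f).mulVec (u ∘ e) ∘ e.symm) i ^ 2]
  simpa using sum_sq_le_historyMatrix_mulVec f (u ∘ e)

lemma isUnit_hardMatrix : IsUnit (hardMatrix e f) := by
  rw [← Matrix.mulVec_injective_iff_isUnit]
  intro u v huv
  have h := sum_sq_le_hardMatrix_mulVec e f (u - v)
  have h0 : (hardMatrix e f).mulVec (u - v) = 0 := by
    rw [Matrix.mulVec_sub]
    exact sub_eq_zero.mpr huv
  rw [h0] at h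
  have h1 : ∑ i, (u - v) i ^ 2 = 0 :=
    le_antisymm (by simpa using h) (Finset.sum_nonneg fun _ _ => sq_nonneg _)
  funext i
  have := (Finset.sum_eq_zero_iff_of_nonneg fun _ _ => sq_nonneg _).mp h1 i (Finset.mem_univ i)
  exact sub_eq_zero.mp (pow_eq_zero_iff two_ne_zero |>.mp this)

lemma ncard_hardMatrix_row_le (i : Fin n) : {j | hardMatrix e f i j ≠ 0}.ncard ≤ 3 := by
  have : {j | hardMatrix e f i j ≠ 0} = e '' {b | historyMatrix r f (e.symm i) b ≠ 0} := by
    ext j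
    simp [hardMatrix, Equiv.image_eq_preimage_symm]
  rw [this, Set.ncard_image_of_injective _ e.injective]
  exact ncard_historyMatrix_row_le f _

lemma isSparseWellConditioned_hardMatrix (hn : 0 < n) {K : ℝ} (hK : 2 * (2 * k + 2) ≤ K) :
    IsSparseWellConditioned 3 K (hardMatrix e f) where
  symm := hardMatrix_isSymm e f
  rank_eq := by rw [Matrix.rank_of_isUnit _ (isUnit_hardMatrix e f), Fintype.card_fin]
  cond_le := (conditionNumber_le hn (by norm_num) (by positivity)
    (sum_sq_hardMatrix_mulVec_le e f) (sum_sq_le_hardMatrix_mulVec e f)).trans hK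
  row_sparse := ncard_hardMatrix_row_le e f
  col_sparse := fun j => by
    have hs : ∀ i, hardMatrix e f i j = hardMatrix e f j i := fun i =>
      (hardMatrix_isSymm e f).apply j i
    simpa only [hs] using ncard_hardMatrix_row_le e f j

/-- The basis state at which a row or column of the matrix meets the sign oracle. -/
def hiddenPoint : SQVector n → Option (Fin k → Bool)
  | .row i => (e.symm i).elim (fun p => some p.2) fun _ => none
  | .col j => (e.symm j).elim (fun p => some p.2) fun _ => none
  | _ => none

variable {f}

lemma hardMatrix_congr {f' : (Fin k → Bool) → Bool} {i : Fin n}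
    (h : ∀ x ∈ hiddenPoint e (.row i), f x = f' x) (j : Fin n) :
    hardMatrix e f i j = hardMatrix e f' i j :=
  historyMatrix_congr (fun t x hx => h x (by simp [hiddenPoint, hx])) _

variable (f)

lemma sq_hardMatrix (f' : (Fin k → Bool) → Bool) (i j : Fin n) :
    hardMatrix e f i j ^ 2 = hardMatrix e f' i j ^ 2 := sq_historyMatrix f f' _ _

/-- All the random choices and all the norms offered to an algorithm are independent of `f`, and
every entry depends on a single value of `f`. -/
lemma hidesFunction_hardMatrix (y : EuclideanSpace ℝ (Fin n)) :
    HidesFunction (hardMatrix e) y (hiddenPoint e) where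
  vec_eq f f' v h := by
    cases v with
    | row i => exact congrArg (WithLp.toLp 2) (funext fun j => hardMatrix_congr e h j)
    | col j =>
      refine congrArg (WithLp.toLp 2) (funext fun i => ?_)
      rw [← (hardMatrix_isSymm e f).apply, ← (hardMatrix_isSymm e f').apply]
      exact hardMatrix_congr e h i
    | rowNorms => exact congrArg (WithLp.toLp 2) (funext fun i =>
        norm_eq_of_sq_eq fun j => sq_hardMatrix e f f' i j)
    | colNorms => exact congrArg (WithLp.toLp 2) (funext fun j =>
        norm_eq_of_sq_eq fun i => sq_hardMatrix e f f' i j)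
    | rhs => rfl
  sq_eq f f' v j := by
    cases v with
    | row i => exact sq_hardMatrix e f f' i j
    | col i => exact sq_hardMatrix e f f' j i
    | rowNorms => exact congrArg (· ^ 2) (norm_eq_of_sq_eq fun l => sq_hardMatrix e f f' j l)
    | colNorms => exact congrArg (· ^ 2) (norm_eq_of_sq_eq fun l => sq_hardMatrix e f f' l j)
    | rhs => rfl
  cost_eq v h := by
    cases v with
    | rhs => exact absurd rfl h
    | _ => rfl

/-- The solution of the hard linear system. -/
noncomputable def hardSolution : EuclideanSpace ℝ (Fin n) :=
  WithLp.toLp 2 (circuitHistory r f ∘ e.symm)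

lemma norm_sq_hardSolution : ‖hardSolution e f‖ ^ 2 = 2 * k + 2 := by
  rw [EuclideanSpace.real_norm_sq_eq, ← Equiv.sum_comp e]
  simpa [hardSolution] using sum_sq_circuitHistory f

lemma hardSolution_ne_zero : hardSolution e f ≠ 0 := by
  intro h
  have := norm_sq_hardSolution e f
  rw [h, norm_zero] at this
  have : (0 : ℝ) ≤ k := Nat.cast_nonneg k
  norm_num at *
  linarith

variable {e}

lemma inv_hardMatrix_mulVec (he : (e (.inl (Fin.last _, fun _ => false)) : ℕ) = 0) :
    WithLp.toLp 2 ((hardMatrix e f)⁻¹.mulVec (firstUnitVector n).ofLp) = hardSolution e f := by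
  have h1 : (hardMatrix e f).mulVec (circuitHistory r f ∘ e.symm) = (firstUnitVector n).ofLp := by
    rw [hardMatrix_mulVec, Function.comp_assoc, Equiv.symm_comp_self, Function.comp_id,
      historyMatrix_mulVec_circuitHistory]
    funext i
    simp only [Function.comp_apply, Pi.single_apply, firstUnitVector, Equiv.symm_apply_eq,
      Fin.ext_iff, he]
  rw [← h1, Matrix.mulVec_mulVec, Matrix.nonsing_inv_mul _
    ((Matrix.isUnit_iff_isUnit_det _).mp (isUnit_hardMatrix e f)), Matrix.one_mulVec]
  rfl

variable (e)

/-- The indices that stand for the final time and a basis state in `U`. -/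
def finalIndices (U : Finset (Fin k → Bool)) : Finset (Fin n) :=
  U.image fun y => e (.inl (Fin.last _, y))

lemma hardSolution_final (y : Fin k → Bool) :
    hardSolution e f (e (.inl (Fin.last _, y))) = circuitState f (2 * k + 1) y := by
  simp [hardSolution, circuitHistory]

variable {e f} {A : QICAlgorithm n} {ε : ℝ}

lemma le_sum_outputProb_final (he : (e (.inl (Fin.last _, fun _ => false)) : ℕ) = 0)
    (hA : A.Solves (hardMatrix e f) (firstUnitVector n) ε) (hε : ε ≤ 1)
    (hεk : ε ^ 2 * (2 * k + 2) ≤ 1 / 4) :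
    ENNReal.ofReal (1 / (16 * (2 * k + 2)))
      ≤ ∑ j ∈ finalIndices e Finset.univ, A.outputProb (hardMatrix e f) (firstUnitVector n) j := by
  obtain ⟨x', hx', hout⟩ := hA
  rw [inv_hardMatrix_mulVec f he] at hx'
  simp only [hout]
  rw [← norm_sq_hardSolution e f] at hεk ⊢
  refine le_sum_sampleProb hε hx' hεk ?_
  rw [finalIndices, Finset.sum_image (fun y _ y' _ h => by simpa using h)]
  simp only [hardSolution_final, sum_sq_circuitState]

lemma sum_outputProb_orthogonal_le (he : (e (.inl (Fin.last _, fun _ => false)) : ℕ) = 0)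
    (hA : A.Solves (hardMatrix e f) (firstUnitVector n) ε) (hε : ε ≤ 1 / 2)
    {s : Fin k → Bool} (hf : ∀ x, f (cubeAdd x s) = !f x) :
    ∑ j ∈ finalIndices e (Finset.univ.filter fun y => cubeChar s y = 1),
      A.outputProb (hardMatrix e f) (firstUnitVector n) j ≤ ENNReal.ofReal (4 * ε ^ 2) := by
  obtain ⟨x', hx', hout⟩ := hA
  rw [inv_hardMatrix_mulVec f he] at hx'
  simp only [hout]
  refine sum_sampleProb_le_of_eq_zero hε (hardSolution_ne_zero e f) hx' fun j hj => ?_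
  simp only [finalIndices, Finset.mem_image, Finset.mem_filter, Finset.mem_univ, true_and] at hj
  obtain ⟨y, hy, rfl⟩ := hj
  rw [hardSolution_final, circuitState_final_eq_zero hf hy]

end HardMatrix

/-! ### The lower bound -/

/-- A function with `f (x + s) = !f x`, as random as `g` is (for `s = 0`, where there is no such
function, the function `g` itself). -/
noncomputable def hiddenShift {k : ℕ} (s : Fin k → Bool) (g : (Fin k → Bool) → Bool) :
    (Fin k → Bool) → Bool :=
  open scoped Classical in if h : ∃ i, s i = true then antiperiodize s h.choose g else g

lemma hiddenShift_cubeAdd {k : ℕ} {s : Fin k → Bool} (hs : s ≠ fun _ => false)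
    (g : (Fin k → Bool) → Bool) (x : Fin k → Bool) :
    hiddenShift s g (cubeAdd x s) = !hiddenShift s g x := by
  have h : ∃ i, s i = true := by
    by_contra hc
    exact hs (funext fun i => by simpa using fun h => hc ⟨i, h⟩)
  rw [hiddenShift, dif_pos h]
  exact antiperiodize_cubeAdd h.choose_spec g x

lemma sum_consistent_hiddenShift {k : ℕ} (s : Fin k → Bool) (Q : List ((Fin k → Bool) × Bool))
    (hQ : ∀ p ∈ Q, ∀ q ∈ Q, q.1 ≠ cubeAdd p.1 s) :
    ∑ g, consistent Q g = ∑ g, consistent Q (hiddenShift s g) := by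
  unfold hiddenShift
  split_ifs with h
  · exact sum_consistent_antiperiodize Q hQ
  · rfl

/-- An algorithm that solves the hard linear systems with at most `q` expected queries on each of
them satisfies this trade-off, for every `t` well below `√(2 ^ k)`: on random inputs it stops at the
final time with probability at least `1 / (16 (2 k + 2))`, and so with at least a quarter of that
probability at a `y` orthogonal to a random shift `s`, whereas it does so with probability at most
`4 ε ^ 2` if the input has the hidden shift `s`. -/
lemma query_tradeoff {k r n t K : ℕ} {e : HistoryIndex k r ≃ Fin n}
    (he : (e (.inl (Fin.last _, fun _ => false)) : ℕ) = 0) {A : QICAlgorithm n} {ε q : ℝ}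
    (hA : ∀ f, A.Solves (hardMatrix e f) (firstUnitVector n) ε) (hε : ε ≤ 1 / 2)
    (hεk : ε ^ 2 * (2 * k + 2) ≤ 1 / 4)
    (hq : ∀ f, A.expectedQueries (hardMatrix e f) (firstUnitVector n) ≤ ENNReal.ofReal q)
    (hq0 : 0 ≤ q) (ht : 0 < t) (hK : 4 * K = 2 ^ k) (htK : t ^ 2 + 1 ≤ K) :
    1 / (16 * (2 * k + 2)) ≤ 16 * ε ^ 2 + q / t := by
  classical
  let I : Finset (Fin k → Bool) := Finset.univ.filter fun s => s ≠ fun _ => false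
  let B : (Fin k → Bool) → Finset (Fin n) := fun s =>
    finalIndices e (Finset.univ.filter fun y => cubeChar s y = 1)
  let free : (Fin k → Bool) → List ((Fin k → Bool) × Bool) → Prop := fun s Q =>
    ∀ p ∈ Q, ∀ q ∈ Q, q.1 ≠ cubeAdd p.1 s
  have key := A.hiding_bound (hidesFunction_hardMatrix e (firstUnitVector n)) ht (K : ℝ≥0∞)
    (finalIndices e Finset.univ) I hiddenShift B free
    (fun s _ Q hQ => (sum_consistent_hiddenShift s Q hQ).le)
    (by
      intro j hj Q hQ
      simp only [finalIndices, Finset.mem_image, Finset.mem_univ, true_and] at hj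
      obtain ⟨y, rfl⟩ := hj
      have h1 : ∀ c : ℕ, 2 ^ k ≤ 2 * (c + t ^ 2 + 1) → K ≤ c := fun c hc => by omega
      refine Nat.cast_le.mpr ((h1 _ (card_orthogonal_free_shifts y Q hQ)).trans
        (Finset.card_le_card fun s hs => ?_))
      simp only [Finset.mem_filter, Finset.mem_univ, true_and] at hs
      simpa [I, B, free, finalIndices] using hs)
  set a : ℝ := 1 / (16 * (2 * k + 2)) with ha
  set G : ℕ := Fintype.card ((Fin k → Bool) → Bool) with hG
  have ha0 : 0 ≤ a := by positivity
  have hGpos : (0 : ℝ) < G := by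
    have : 0 < G := Fintype.card_pos
    exact_mod_cast this
  have hKpos : (0 : ℝ) < K := by
    have : 0 < K := by omega
    exact_mod_cast this
  have htpos : (0 : ℝ) < t := by exact_mod_cast ht
  have hI : I.card ≤ 4 * K := by
    rw [hK]
    refine (Finset.card_le_univ _).trans ?_
    simp
  have hlow : ENNReal.ofReal (K * (G * a)) ≤ (K : ℝ≥0∞) * ∑ g : (Fin k → Bool) → Bool,
      ∑ j ∈ finalIndices e Finset.univ,
        A.outputProb (hardMatrix e g) (firstUnitVector n) j := by
    rw [ENNReal.ofReal_mul hKpos.le, ENNReal.ofReal_mul hGpos.le, ENNReal.ofReal_natCast,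
      ENNReal.ofReal_natCast]
    gcongr
    have := Finset.card_nsmul_le_sum (Finset.univ : Finset ((Fin k → Bool) → Bool))
      (fun g => ∑ j ∈ finalIndices e Finset.univ,
        A.outputProb (hardMatrix e g) (firstUnitVector n) j) (ENNReal.ofReal a)
      (fun g _ => le_sum_outputProb_final he (hA g) (by linarith) hεk)
    rwa [Finset.card_univ, nsmul_eq_mul] at this
  have hshift : ∑ s ∈ I, ∑ g, ∑ j ∈ B s,
      A.outputProb (hardMatrix e (hiddenShift s g)) (firstUnitVector n) j
      ≤ ENNReal.ofReal (4 * K * (G * (4 * ε ^ 2))) := by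
    calc _ ≤ ∑ s ∈ I, (G : ℝ≥0∞) * ENNReal.ofReal (4 * ε ^ 2) := by
          refine Finset.sum_le_sum fun s hs => ?_
          have hs' : s ≠ fun _ => false := by simpa [I] using hs
          have := Finset.sum_le_card_nsmul (Finset.univ : Finset ((Fin k → Bool) → Bool))
            (fun g => ∑ j ∈ B s,
              A.outputProb (hardMatrix e (hiddenShift s g)) (firstUnitVector n) j)
            (ENNReal.ofReal (4 * ε ^ 2))
            (fun g _ => sum_outputProb_orthogonal_le he (hA _) hε (hiddenShift_cubeAdd hs' g))
          rwa [Finset.card_univ, nsmul_eq_mul] at this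
      _ ≤ ((4 * K : ℕ) : ℝ≥0∞) * ((G : ℝ≥0∞) * ENNReal.ofReal (4 * ε ^ 2)) := by
          rw [Finset.sum_const, nsmul_eq_mul]
          gcongr
      _ = _ := by
          rw [← ENNReal.ofReal_natCast G, ← ENNReal.ofReal_mul hGpos.le,
            ← ENNReal.ofReal_natCast (4 * K), ← ENNReal.ofReal_mul (by positivity)]
          push_cast
          rfl
  have hqueries : (K : ℝ≥0∞) / t * ∑ g, A.expectedQueries (hardMatrix e g) (firstUnitVector n)
      ≤ ENNReal.ofReal (K / t * (G * q)) := by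
    rw [ENNReal.ofReal_mul (by positivity), ENNReal.ofReal_mul hGpos.le,
      ENNReal.ofReal_div_of_pos htpos, ENNReal.ofReal_natCast, ENNReal.ofReal_natCast,
      ENNReal.ofReal_natCast]
    gcongr
    have := Finset.sum_le_card_nsmul (Finset.univ : Finset ((Fin k → Bool) → Bool))
      (fun g => A.expectedQueries (hardMatrix e g) (firstUnitVector n)) (ENNReal.ofReal q)
      (fun g _ => hq g)
    rwa [Finset.card_univ, nsmul_eq_mul] at this
  have hfin := (hlow.trans key).trans (add_le_add hshift hqueries)
  rw [← ENNReal.ofReal_add (by positivity) (by positivity),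
    ENNReal.ofReal_le_ofReal_iff (by positivity)] at hfin
  have hKG : (0 : ℝ) < K * G := mul_pos hKpos hGpos
  refine le_of_mul_le_mul_left (hfin.trans (le_of_eq ?_) |>.trans' (le_of_eq ?_)) hKG
  · ring
  · ring

lemma two_mul_add_two_le_two_pow {k : ℕ} (hk : 3 ≤ k) : 2 * k + 2 ≤ 2 ^ k := by
  induction k, hk using Nat.le_induction with
  | base => norm_num
  | succ k hk ih =>
    rw [pow_succ]
    omega

lemma exists_historyIndex_equiv {k n : ℕ} (hk : 3 ≤ k) (hn : 4 ^ k ≤ n) :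
    ∃ (r : ℕ) (e : HistoryIndex k r ≃ Fin n),
      (e (.inl (Fin.last _, fun _ => false)) : ℕ) = 0 := by
  have hsize : (2 * k + 2) * 2 ^ k ≤ n := by
    refine le_trans ?_ hn
    have : (4 : ℕ) ^ k = 2 ^ k * 2 ^ k := by
      rw [← mul_pow]
      norm_num
    rw [this]
    exact Nat.mul_le_mul_right _ (two_mul_add_two_le_two_pow hk)
  have hn0 : 0 < n := lt_of_lt_of_le (by positivity) hn
  have hcard : Fintype.card (HistoryIndex k (n - (2 * k + 2) * 2 ^ k)) = Fintype.card (Fin n) := by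
    simp
    omega
  let e₀ := Fintype.equivOfCardEq hcard
  refine ⟨_, e₀.trans (Equiv.swap (e₀ (.inl (Fin.last _, fun _ => false))) ⟨0, hn0⟩), ?_⟩
  simp

theorem theorem1 :
    ∃ c : ℝ, 0 < c ∧ ∃ C : ℝ, 0 < C ∧
      ∀ n : ℕ, c ≤ n → ∀ ε : ℝ, 0 < ε → ε ≤ (c * √(Real.log n))⁻¹ →
        ∀ A : QICAlgorithm n,
          (∀ M : Matrix (Fin n) (Fin n) ℝ, IsSparseWellConditioned 3 (c * Real.log n) M →
            A.Solves M (firstUnitVector n) ε) →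
          ∃ M : Matrix (Fin n) (Fin n) ℝ, IsSparseWellConditioned 3 (c * Real.log n) M ∧
            ENNReal.ofReal (C * ((n : ℝ) ^ (1 / 4 : ℝ) / Real.log n ^ (3 / 2 : ℝ))) ≤
              A.expectedQueries M (firstUnitVector n) := by
  refine ⟨4 ^ 6, by norm_num, 1 / 2048, by norm_num, ?_⟩
  intro n hn ε hε0 hε A hA
  have hn' : 4 ^ 6 ≤ n := by exact_mod_cast hn
  have hn0 : n ≠ 0 := by omega
  have hnR : (0 : ℝ) < n := by positivity
  -- A cube of size about `√n` leaves room for the times of the circuit.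
  set k := Nat.log 4 n with hk
  have hkn : 4 ^ k ≤ n := Nat.pow_log_le_self 4 hn0
  have hnk : n < 4 ^ (k + 1) := Nat.lt_pow_succ_log_self (by norm_num) n
  have hk6 : 6 ≤ k := Nat.le_log_of_pow_le (by norm_num) hn'
  set l := Real.log n with hl
  have hlog4 : 1 ≤ Real.log 4 := by
    have h := Real.log_two_gt_d9
    have : Real.log 4 = 2 * Real.log 2 := by
      rw [← Real.log_rpow (by norm_num)]
      norm_num
    linarith
  have hkl : (k : ℝ) ≤ l := by
    have h1 : Real.log ((4 : ℝ) ^ k) ≤ l :=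
      Real.log_le_log (by positivity) (by exact_mod_cast hkn)
    rw [Real.log_pow] at h1
    nlinarith [(Nat.cast_nonneg k : (0 : ℝ) ≤ k)]
  have hk6' : (6 : ℝ) ≤ k := by exact_mod_cast hk6
  have hl1 : 1 ≤ l := by linarith
  have hε2 : ε ^ 2 * l ≤ 1 / (4 ^ 6) ^ 2 := by
    have h1 := pow_le_pow_left₀ hε0.le hε 2
    rw [inv_pow, mul_pow, Real.sq_sqrt (by linarith)] at h1
    have h2 := mul_le_mul_of_nonneg_right h1 (by linarith : 0 ≤ l)
    refine h2.trans (le_of_eq ?_)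
    field_simp
  obtain ⟨r, e, he⟩ := exists_historyIndex_equiv (by omega : 3 ≤ k) hkn
  have hmem : ∀ f, IsSparseWellConditioned 3 (4 ^ 6 * l) (hardMatrix e f) := fun f =>
    isSparseWellConditioned_hardMatrix e f (by omega) (by linarith)
  by_contra hcon
  push Not at hcon
  -- The largest power of two that satisfies the bound on `t` in `query_tradeoff`.
  set t := 2 ^ ((k - 3) / 2) with ht
  have hK : 4 * 2 ^ (k - 2) = 2 ^ k := by
    have : (4 : ℕ) = 2 ^ 2 := by norm_num
    rw [this, ← pow_add]
    congr 1
    omega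
  have htK : t ^ 2 + 1 ≤ 2 ^ (k - 2) := by
    have h1 : t ^ 2 ≤ 2 ^ (k - 3) := by
      rw [ht, ← pow_mul]
      exact Nat.pow_le_pow_right (by norm_num) (by omega)
    have h2 : 2 ^ (k - 2) = 2 * 2 ^ (k - 3) := by
      rw [← pow_succ']
      congr 1
      omega
    have h3 : 0 < 2 ^ (k - 3) := by positivity
    omega
  have hnt : (n : ℝ) ^ (1 / 4 : ℝ) ≤ 8 * t := by
    have h1 : n ≤ (8 * t) ^ 4 := by
      refine hnk.le.trans ?_
      have h4 : (4 : ℕ) ^ (k + 1) = 2 ^ (2 * (k + 1)) := by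
        rw [pow_mul]
        norm_num
      have h8 : (8 * t) ^ 4 = 2 ^ (12 + (k - 3) / 2 * 4) := by
        rw [ht, mul_pow, ← pow_mul, pow_add]
        norm_num
      rw [h4, h8]
      exact Nat.pow_le_pow_right (by norm_num) (by omega)
    have h2 : (n : ℝ) ≤ (8 * t : ℝ) ^ 4 := by exact_mod_cast h1
    calc (n : ℝ) ^ (1 / 4 : ℝ) ≤ ((8 * t : ℝ) ^ 4) ^ (1 / 4 : ℝ) :=
          Real.rpow_le_rpow hnR.le h2 (by norm_num)
      _ = 8 * t := by
          rw [← Real.rpow_natCast, ← Real.rpow_mul (by positivity)]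
          norm_num
  have htpos : 0 < t := by positivity
  have htR : (0 : ℝ) < t := by exact_mod_cast htpos
  have hll : l ≤ l ^ (3 / 2 : ℝ) := by
    calc l = l ^ (1 : ℝ) := (Real.rpow_one l).symm
      _ ≤ l ^ (3 / 2 : ℝ) := Real.rpow_le_rpow_of_exponent_le hl1 (by norm_num)
  have hεhalf : ε ≤ 1 / 2 := by nlinarith
  have main := query_tradeoff (K := 2 ^ (k - 2)) (t := t) he (fun f => hA _ (hmem f)) hεhalf
    (by nlinarith [mul_le_mul_of_nonneg_left hkl (sq_nonneg ε),
      mul_le_mul_of_nonneg_left hl1 (sq_nonneg ε)])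
    (fun f => (hcon _ (hmem f)).le) (by positivity) htpos hK htK
  have hlpos : 0 < l := by linarith
  have h1 : 1 / (64 * l) ≤ 1 / (16 * (2 * (k : ℝ) + 2)) :=
    one_div_le_one_div_of_le (by positivity) (by linarith)
  have h2 : 1 / 2048 * ((n : ℝ) ^ (1 / 4 : ℝ) / l ^ (3 / 2 : ℝ)) / t ≤ 1 / (256 * l) := by
    have h3 : (n : ℝ) ^ (1 / 4 : ℝ) / l ^ (3 / 2 : ℝ) ≤ 8 * t / l :=
      div_le_div₀ (by positivity) hnt hlpos hll
    calc _ ≤ 1 / 2048 * (8 * t / l) / t := by gcongr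
      _ = 1 / (256 * l) := by
        field_simp
        norm_num
  have h3 : 1 / (64 * l) ≤ 16 * ε ^ 2 + 1 / (256 * l) := by linarith
  have h4 : 1 / 64 ≤ 16 * (ε ^ 2 * l) + 1 / 256 := by
    have := mul_le_mul_of_nonneg_right h3 hlpos.le
    have e1 : 1 / (64 * l) * l = 1 / 64 := by field_simp
    have e2 : 1 / (256 * l) * l = 1 / 256 := by field_simp
    rw [add_mul, e1, e2] at this
    linarith
  norm_num at hε2
  linarith
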